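/- Let $k=\mathbb R$ or $\mathbb C$, let $V$ be a $k$-vector space of finite dimension $n>2$ with basis $x_1,\dots,x_n$, and let $S:V\otimes V\to V\otimes V$ be an involutory solution of the quantum Yang–Baxter equation, $S^{12}S^{23}S^{12}=S^{23}S^{12}S^{23}$, $S^2=\mathrm{Id}$, that is invertible by column (writing $S(x_i\otimes x_j)=S_{ij}^{kl}x_k\otimes x_l$, there is $T$ with $S_{ij}^{kl}T_{km}^{in}=\delta_m^l\delta_j^n$). Assume that $S$ is even of rank $2$: the Poincaré series $P_-(t)=\sum_l \dim\wedge_-^l(V)\,t^l$ of $\wedge_-(V)=T(V)/\{\mathrm{Im}(\mathrm{Id}+S)\}$ is a monic polynomial of degree $2$. Assume also that its determinant is central: the projector $\frac12(\mathrm{Id}-S)$ is $x_i\otimes x_j\mapsto u_{ij}\,v$ with $v=v^{kl}x_k\otimes x_l$, $u_{ij}v^{ij}=1$, and $-2\,u_{ai}v^{ja}=\delta_i^j=-2\,u_{ia}v^{aj}$. Extend $S$ to an involutory twist of $V\oplus V^*$ for which the pairing $V^*\otimes V\to k$ is invariant, hence to $\mathrm{End}\,V=V\otimes V^*$. Let $[\,,]=\circ(\mathrm{Id}-S_{\mathrm{End}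 V})$, let $\mathrm{tr}:\mathrm{End}\,V=V\otimes V^*\xrightarrow{S}V^*\otimes V\to k$ be the twisted trace (so $\mathrm{tr}\,\mathrm{Id}=2$), and let ${\bf g}=sl(V_S)=\ker \mathrm{tr}$ with the restricted twist and bracket. Let $e_i^j(x_l)=\delta_l^j x_i$, $C_i^j=\mathrm{tr}\,e_i^j$, $B=C^{-1}$ and $f_i^j=e_i^j-\frac12C_i^j\,\mathrm{Id}\in{\bf g}$. For $c\in k$, $c\neq0$, the twisted non-quasiclassical hyperboloid is the algebra $$\mathcal A_c=T({\bf g})\big/\Big\{X\otimes Y-S(X\otimes Y)\ (X,Y\in{\bf g}),\ \ \sum_{i,j,l}B_i^j\, f_l^i\otimes f_j^l-c\Big\}.$$ Then there is exactly one linear map $\rho:{\bf g}\to\mathrm{End}_k(\mathcal A_c)$ extending the adjoint action by twisted vector fields, i.e. with $\rho(X)1=0$ and $\rho(X)(Ya)=[X,Y]a+\sum Y'\rho(X')a$ for $X,Y\in{\bf g}$, $a\in\mathcal A_c$, where $S(X\otimes Y)=\sum Y'\otimes X'$. Let $\mathcal C_{sl}=\sum_{i,j,l} B_i^j\,\rho(f_l^i)\rho(f_j^l)$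 be the twisted Casimir operator on $\mathcal A_c$. Its eigenvalues are real, and the number $N(\lambda)$ of its eigenvalues $\le\lambda$, counted with multiplicity (the dimension of the sum of the corresponding eigenspaces), is finite for every real $\lambda$. Let $\alpha_1<\alpha_2$ be the roots of $1-nt+t^2=0$. There is a constant $\beta>0$ such that $$\limsup_{\lambda\to+\infty}\frac{N(\lambda)}{\alpha_2^{\sqrt{2\lambda}+2}}=\beta,\qquad \liminf_{\lambda\to+\infty}\frac{N(\lambda)}{\alpha_2^{\sqrt{2\lambda}}}=\beta .$$ In particular $N(\lambda)$ grows exponentially in $\sqrt\lambda$, and $N(\lambda)/\alpha_2^{\sqrt{2\lambda}}$ has no limit (finite or infinite) as $\lambda\to+\infty$. -/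

import Mathlib

open Filter Topology
open scoped TensorProduct

noncomputable section

namespace TwistedHyperboloid

section Twists

variable {k V : Type*} [Field k] [AddCommGroup V] [Module k V]

/-- `S ⊗ id` on `V ⊗ V ⊗ V`. -/
def twist12 (S : V ⊗[k] V →ₗ[k] V ⊗[k] V) :
    (V ⊗[k] V) ⊗[k] V →ₗ[k] (V ⊗[k] V) ⊗[k] V :=
  S.rTensor V

/-- `id ⊗ S` on `V ⊗ V ⊗ V`. -/
def twist23 (S : V ⊗[k] V →ₗ[k] V ⊗[k] V) :
    (V ⊗[k] V) ⊗[k] V →ₗ[k] (V ⊗[k] V) ⊗[k] V :=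
  (TensorProduct.assoc k V V V).symm.toLinearMap ∘ₗ S.lTensor V ∘ₗ
    (TensorProduct.assoc k V V V).toLinearMap

/-- The map `V* ⊗ V → End V` sending `φ ⊗ x` to the operator `y ↦ (φ ⊗ id) (S (x ⊗ y))`.
In a basis, where `S (x_i ⊗ x_j) = S_{ij}^{kl} x_k ⊗ x_l`, it sends `x^k ⊗ x_i` to the operator
`x_j ↦ S_{ij}^{kl} x_l`. -/
def columnMap (S : V ⊗[k] V →ₗ[k] V ⊗[k] V) :
    Module.Dual k V ⊗[k] V →ₗ[k] Module.End k V :=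
  TensorProduct.lift <| LinearMap.mk₂ k
    (fun φ x => (TensorProduct.lid k V).toLinearMap ∘ₗ φ.rTensor V ∘ₗ S ∘ₗ
      TensorProduct.mk k V V x)
    (fun φ ψ x => by ext y; simp [LinearMap.rTensor_add])
    (fun a φ x => by ext y; simp [LinearMap.rTensor_smul])
    (fun φ x y => by ext z; simp)
    (fun a φ x => by ext z; simp)

variable (k V) in
/-- A symmetry: an involutory solution `S` of the quantum Yang-Baxter equation on `V ⊗ V` that is
invertible by column. The last condition says that the matrix `S_{ij}^{kl}`, with rows indexed
by `(k, i)` and columns by `(j, l)`, is invertible, that is, there is a `T` with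
`S_{ij}^{kl} T_{km}^{in} = δ_m^l δ_j^n`. -/
structure Symmetry where
  /-- the operator `S` -/
  op : V ⊗[k] V →ₗ[k] V ⊗[k] V
  involutory : op ∘ₗ op = LinearMap.id
  yang_baxter : twist12 op ∘ₗ twist23 op ∘ₗ twist12 op = twist23 op ∘ₗ twist12 op ∘ₗ twist23 op
  column_invertible : Function.Bijective (columnMap op)

end Twists

namespace Symmetry

variable {k V : Type*} [Field k] [AddCommGroup V] [Module k V]

/-! ### Skew-symmetric algebra, rank, determinant -/

section Even

variable (S : Symmetry k V)

/-- The relations `(id + S) t = 0`, `t ∈ V ⊗ V`, of the skew-symmetric algebra. -/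
inductive SkewRel : TensorAlgebra k V → TensorAlgebra k V → Prop
  | skew (t : V ⊗[k] V) :
      SkewRel (LinearMap.mul' k (TensorAlgebra k V)
        (TensorProduct.map (TensorAlgebra.ι k) (TensorAlgebra.ι k) (t + S.op t))) 0

/-- The skew-symmetric algebra `∧₋(V) = T(V) / {Im (id + S)}`. -/
abbrev SkewAlgebra : Type _ := RingQuot S.SkewRel

/-- The homogeneous component of degree `l` of `∧₋(V)`, the image of `V^{⊗ l}`. -/
def skewComponent (l : ℕ) : Submodule k S.SkewAlgebra :=
  LinearMap.range ((RingQuot.mkAlgHom k S.SkewRel).toLinearMap ∘ₗ TensorAlgebra.ι k) ^ l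

/-- The Poincaré series `P₋(t) = ∑ dim ∧₋^l(V) t^l`. -/
def poincareSeries : PowerSeries ℤ :=
  PowerSeries.mk fun l => (Module.finrank k (S.skewComponent l) : ℤ)

/-- `S` is even of rank `p`: the Poincaré series `P₋(t)` is a monic polynomial of degree `p`. -/
def IsEvenOfRank (p : ℕ) : Prop :=
  ∃ P : Polynomial ℤ, P.Monic ∧ P.natDegree = p ∧ (P : PowerSeries ℤ) = S.poincareSeries

/-- `v` (the determinant) and `u` (the codeterminant) describe the projector `(id - S) / 2` of
`V ⊗ V` onto the skew-symmetric tensors, for a symmetry of rank 2: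
`x ⊗ y ↦ u (x ⊗ y) v`, with `u v = 1`. -/
def IsDetPair (u : V ⊗[k] V →ₗ[k] k) (v : V ⊗[k] V) : Prop :=
  (∀ t, (2 : k)⁻¹ • (t - S.op t) = u t • v) ∧ u v = 1

/-- The determinant of a symmetry of rank `p = 2` is central: `(-1)^{p-1} p M = id` and
`(-1)^{p-1} p N = id`, where `M_i^j = u_{ai} v^{ja}` and `N_i^j = u_{ia} v^{aj}`. (The pair
`(u, v)` is unique up to `(a⁻¹ u, a v)`, which does not change `M` and `N`.) -/
def HasCentralDet : Prop :=
  ∃ (u : V ⊗[k] V →ₗ[k] k) (v : V ⊗[k] V), S.IsDetPair u v ∧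
    (∀ x : V, (-2 : k) • TensorProduct.rid k V
      ((u ∘ₗ (TensorProduct.mk k V V).flip x).lTensor V v) = x) ∧
    (∀ x : V, (-2 : k) • TensorProduct.lid k V
      ((u ∘ₗ TensorProduct.mk k V V x).rTensor V v) = x)

end Even

/-! ### Extension of the symmetry to `V*` and to `End V = V ⊗ V*` -/

section Dual

variable [FiniteDimensional k V]

variable (k V) in
/-- `V ⊗ V* ≃ End V`, where `x ⊗ φ` is the operator `y ↦ φ y • x`. -/
def endEquiv : V ⊗[k] Module.Dual k V ≃ₗ[k] Module.End k V :=
  TensorProduct.comm k V (Module.Dual k V) ≪≫ₗ dualTensorHomEquiv k V V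

variable (S : Symmetry k V)

/-- The twist `V* ⊗ V → V ⊗ V*`: the only one for which the pairing `V* ⊗ V → k` is invariant. -/
def dualLeft : Module.Dual k V ⊗[k] V ≃ₗ[k] V ⊗[k] Module.Dual k V :=
  LinearEquiv.ofBijective (columnMap S.op) S.column_invertible ≪≫ₗ (endEquiv k V).symm

/-- The twist `V ⊗ V* → V* ⊗ V`: the inverse of the previous one, as the extended twist is
involutory. -/
def dualRight : V ⊗[k] Module.Dual k V →ₗ[k] Module.Dual k V ⊗[k] V :=
  S.dualLeft.symm.toLinearMap

/-- The twist `V* ⊗ V* → V* ⊗ V*`: the transpose of `S`, where `φ ⊗ ψ` is paired with `x ⊗ y` by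
`ψ x * φ y` (inner factors first). -/
def dualDual :
    Module.Dual k V ⊗[k] Module.Dual k V →ₗ[k] Module.Dual k V ⊗[k] Module.Dual k V :=
  (TensorProduct.comm k _ _).toLinearMap ∘ₗ
    (TensorProduct.dualDistribEquiv k V V).symm.toLinearMap ∘ₗ
    S.op.dualMap ∘ₗ
    (TensorProduct.dualDistribEquiv k V V).toLinearMap ∘ₗ
    (TensorProduct.comm k _ _).toLinearMap

/-- The twist of `V ⊗ V*` with itself: two neighbours are interchanged at a time. -/
def pairTwist :
    (V ⊗[k] Module.Dual k V) ⊗[k] (V ⊗[k] Module.Dual k V) →ₗ[k]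
      (V ⊗[k] Module.Dual k V) ⊗[k] (V ⊗[k] Module.Dual k V) :=
  (TensorProduct.tensorTensorTensorAssoc k V _ V _).symm.toLinearMap ∘ₗ
    (S.dualRight.lTensor V).rTensor (Module.Dual k V) ∘ₗ
    (TensorProduct.tensorTensorTensorAssoc k V V _ _).toLinearMap ∘ₗ
    TensorProduct.map S.op S.dualDual ∘ₗ
    (TensorProduct.tensorTensorTensorAssoc k V V _ _).symm.toLinearMap ∘ₗ
    (S.dualLeft.toLinearMap.lTensor V).rTensor (Module.Dual k V) ∘ₗ
    (TensorProduct.tensorTensorTensorAssoc k V _ V _).toLinearMap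

/-- The twist `S_{End V}` on `End V ⊗ End V`. -/
def endTwist :
    Module.End k V ⊗[k] Module.End k V →ₗ[k] Module.End k V ⊗[k] Module.End k V :=
  (TensorProduct.congr (endEquiv k V) (endEquiv k V)).toLinearMap ∘ₗ S.pairTwist ∘ₗ
    (TensorProduct.congr (endEquiv k V) (endEquiv k V)).symm.toLinearMap

/-- The bracket `∘ (id - S_{End V})` of the twisted Lie algebra `gl(V_S)`. -/
def glBracket : Module.End k V ⊗[k] Module.End k V →ₗ[k] Module.End k V :=
  LinearMap.mul' k (Module.End k V) ∘ₗ (LinearMap.id - S.endTwist)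

/-- The `S`-trace on `End V = V ⊗ V*`: the twist `V ⊗ V* → V* ⊗ V` followed by the pairing. -/
def str : Module.End k V →ₗ[k] k :=
  contractLeft k V ∘ₗ S.dualRight ∘ₗ (endEquiv k V).symm.toLinearMap

/-! ### The twisted Lie algebra `sl(V_S)` -/

/-- The space `sl(V_S)` of operators of `S`-trace zero. -/
abbrev sl : Submodule k (Module.End k V) := LinearMap.ker S.str

/-- The projection `X ↦ X - p⁻¹ tr(X) id` of `gl(V_S)` onto `sl(V_S)`, `p = tr(id)`, in the form
`p⁻¹ (p X - tr(X) id)`, whose trace vanishes without assuming `p ≠ 0`. -/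
def slProj : Module.End k V →ₗ[k] S.sl :=
  LinearMap.codRestrict S.sl
    ((S.str 1)⁻¹ • (S.str 1 • LinearMap.id - S.str.smulRight (1 : Module.End k V)))
    (fun X => by simp [mul_comm])

/-- The twist of `sl(V_S)`. Since `S_{End V}` maps `sl ⊗ sl` into itself (the trace being
invariant), the final projection only serves to land in the right type. -/
def slTwist : S.sl ⊗[k] S.sl →ₗ[k] S.sl ⊗[k] S.sl :=
  TensorProduct.map S.slProj S.slProj ∘ₗ S.endTwist ∘ₗ
    TensorProduct.map S.sl.subtype S.sl.subtype

/-- The bracket of `sl(V_S)`, the restriction of that of `gl(V_S)`. Since brackets have trace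
zero, the final projection only serves to land in the right type. -/
def slBracket : S.sl ⊗[k] S.sl →ₗ[k] S.sl :=
  S.slProj ∘ₗ S.glBracket ∘ₗ TensorProduct.map S.sl.subtype S.sl.subtype

variable {n : ℕ} (x : Module.Basis (Fin n) k V)

/-- The operator `e_i^j = x_i ⊗ x^j`, that is, `x_l ↦ δ_l^j x_i`. -/
def matUnit (i j : Fin n) : Module.End k V := (x.coord j).smulRight (x i)

/-- The matrix `C_i^j = tr(e_i^j)`. -/
def matC : Matrix (Fin n) (Fin n) k := Matrix.of fun i j => S.str (matUnit x i j)

/-- The matrix `B`, the inverse of `C`. -/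
def matB : Matrix (Fin n) (Fin n) k := (S.matC x)⁻¹

/-- The generator `f_i^j = e_i^j - p⁻¹ C_i^j id` of `sl(V_S)`. -/
def slGen (i j : Fin n) : S.sl := S.slProj (matUnit x i j)

/-- The Casimir tensor `∑ B_i^j f_l^i ⊗ f_j^l`. -/
def casimirTensor : S.sl ⊗[k] S.sl :=
  ∑ i, ∑ j, ∑ l, S.matB x i j • (S.slGen x l i ⊗ₜ[k] S.slGen x j l)

/-! ### The twisted hyperboloid and its Casimir operator -/

/-- The map `sl ⊗ sl → T(sl)`, `X ⊗ Y ↦ X Y`. -/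
def quadratic : S.sl ⊗[k] S.sl →ₗ[k] TensorAlgebra k S.sl :=
  LinearMap.mul' k (TensorAlgebra k S.sl) ∘ₗ
    TensorProduct.map (TensorAlgebra.ι k) (TensorAlgebra.ι k)

/-- The defining relations of the algebra `A_c`: `S`-commutativity of the elements of `sl(V_S)`,
and `∑ B_i^j f_l^i f_j^l = c`. -/
inductive HyperboloidRel (c : k) : TensorAlgebra k S.sl → TensorAlgebra k S.sl → Prop
  | comm (t : S.sl ⊗[k] S.sl) : HyperboloidRel c (S.quadratic t) (S.quadratic (S.slTwist t))
  | quadric : HyperboloidRel c (S.quadratic (S.casimirTensor x)) (algebraMap k _ c)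

/-- The algebra `A_c`; for `c ≠ 0` it is the twisted hyperboloid. -/
abbrev Hyperboloid (c : k) : Type _ := RingQuot (S.HyperboloidRel x c)

/-- The canonical map `sl(V_S) → A_c`. -/
def gen (c : k) : S.sl →ₗ[k] S.Hyperboloid x c :=
  (RingQuot.mkAlgHom k (S.HyperboloidRel x c)).toLinearMap ∘ₗ TensorAlgebra.ι k

/-- `ρ` is the adjoint action of `sl(V_S)` on `A_c` by twisted vector fields: `ρ X` kills
constants, and `ρ X (Y a) = [X, Y] a + ∑ Y' ρ(X') a` where `∑ Y' ⊗ X'` is the twist of `X ⊗ Y`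
(the twisted Leibniz rule; for `a = 1` it says that `ρ X Y = [X, Y]` on generators). -/
structure IsAdjointAction {c : k} (ρ : S.sl →ₗ[k] Module.End k (S.Hyperboloid x c)) : Prop where
  map_one : ∀ X : S.sl, ρ X 1 = 0
  leibniz : ∀ (X Y : S.sl) (a : S.Hyperboloid x c),
    ρ X (S.gen x c Y * a) = S.gen x c (S.slBracket (X ⊗ₜ[k] Y)) * a +
      LinearMap.mul' k (Module.End k (S.Hyperboloid x c))
        (TensorProduct.map ((Algebra.lmul k (S.Hyperboloid x c)).toLinearMap ∘ₗ S.gen x c) ρ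
          (S.slTwist (X ⊗ₜ[k] Y))) a

/-- The Casimir operator `C_sl = ∑ B_i^j ρ(f_l^i) ρ(f_j^l)` on `A_c`. -/
def casimirOp {c : k} (ρ : S.sl →ₗ[k] Module.End k (S.Hyperboloid x c)) :
    Module.End k (S.Hyperboloid x c) :=
  LinearMap.mul' k (Module.End k (S.Hyperboloid x c))
    (TensorProduct.map ρ ρ (S.casimirTensor x))

end Dual

end Symmetry

section Counting

variable {k A : Type*} [RCLike k] [AddCommGroup A] [Module k A]

/-- The sum of the eigenspaces of `C` for the real eigenvalues `≤ t`. -/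
def eigenspacesLE (C : Module.End k A) (t : ℝ) : Submodule k A :=
  ⨆ (μ : ℝ) (_ : μ ≤ t), Module.End.eigenspace C (μ : k)

/-- The number `N(t)` of eigenvalues `≤ t` of `C`, counted with multiplicity. -/
def eigenvalueCount (C : Module.End k A) (t : ℝ) : ℕ :=
  Module.finrank k (eigenspacesLE C t)

end Counting

end TwistedHyperboloid

end

open TwistedHyperboloid

/-! # Spectrum of the Casimir operator on a twisted hyperboloid

A symmetry `S` of rank 2 with central determinant has the form
`S (x ⊗ y) = x ⊗ y + B x y • ∑ e i ⊗ f i`, where `∑ e i ⊗ f i` is inverse to the bilinear form `B`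
and `∑ B (e i) (f i) = -2` (`Symmetry.HasCentralDet.exists_form`, `RankTwoForm`). Through
`V ≃ V*`, `y ↦ B y`, the twist, the bracket and the trace of `End V` become explicit, and `sl(V_S)`
is spanned by operators `x ⊗ y` subject to `∑ e i ⊗ f i = 0` (`slTwist_slOp`, `slBracket_slOp`).
In these terms all the relations of `A_c` say that
`∑ (x ⊗ e i) (f i ⊗ y) = (c / 2) B x y` (`sum_hypGen_mul_hypGen`).

The algebra is realized on the even part of the symmetric algebra `Q = T(V) / (∑ e i f i)` of `S`.
On `Q` there are twisted partial derivatives with `∂_x (y q) = B x y (q + E q) + x ∂_y q`, `E = ∑ e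
i ∂_{f i}` being the Euler operator, whose eigenspaces are the homogeneous components `Q_m`. The
generator `x ⊗ y` of `A_c` acts on `Q_m`, `m` even, by `x y - c / (2 (m - 1) (m + 1)) ∂_x ∂_y`
(`mulOp`), and `a ↦ a 1` is a bijection of `A_c` with the even part (`orbit_bijective`): surjective
as `x y` is the leading term of the action, injective as it has an explicit left inverse. On the
other side of this bijection, `x ∂_y + B x y E / 2` satisfies the twisted Leibniz rule
(`adOp_mulOp`), hence gives the adjoint action, and its Casimir operator is `E (E + 2) / 2`
(`sum_sum_adOp_adOp`). So the eigenvalues are `2 r (r + 1)`, with multiplicity `dim Q_{2 r}`.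

The map `x ⊗ q ↦ (∂_x q, x q)` is an isomorphism of `V ⊗ Q_{m+1}` with `Q_m × Q_{m+2}`
(`degMap_bijective`). The dimensions `d_m` of the `Q_m` therefore satisfy
`d_m + d_{m+2} = n d_{m+1}`, that is, `d_m = (α₂ ^ (m + 1) - α₁ ^ (m + 1)) / (α₂ - α₁)`, and as
`α₁ α₂ = 1` the number of eigenvalues up to `2 r (r + 1)` is `∑ d_{2 s} = d_r ^ 2`
(`sum_even_eq_sq`), asymptotic to `α₂ ^ (2 r + 2) / (α₂ - α₁) ^ 2`. At the `r`-th eigenvalue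
`√(2 λ)` is close to `2 r + 1`, and just before the next one it is close to `2 r + 3`; this gives
the upper and the lower limit (`limsup_liminf_of_level`), with
`β = (α₂ (α₂ - α₁) ^ 2)⁻¹`. -/

noncomputable section

namespace TwistedHyperboloid

/-! ### The twisted symmetric algebra and its derivations -/

/-- In an algebra generated by the image of a module, a subspace which contains `1` and is stable
under left multiplication by the generators is everything. -/
theorem eq_top_of_one_mem_of_mul_mem {k M A : Type*} [CommSemiring k] [AddCommMonoid M]
    [Module k M] [Semiring A] [Algebra k A] (φ : TensorAlgebra k M →ₐ[k] A)
    (hφ : Function.Surjective φ) (N : Submodule k A) (h1 : (1 : A) ∈ N)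
    (hmul : ∀ m, ∀ a ∈ N, φ (TensorAlgebra.ι k m) * a ∈ N) : N = ⊤ := by
  have key : ∀ t : TensorAlgebra k M, ∀ a ∈ N, φ t * a ∈ N := by
    intro t
    induction t using TensorAlgebra.induction with
    | algebraMap r =>
      intro a ha
      rw [AlgHom.commutes, ← Algebra.smul_def]
      exact N.smul_mem _ ha
    | ι m => exact hmul m
    | mul s t hs ht =>
      intro a ha
      rw [map_mul, mul_assoc]
      exact hs _ (ht _ ha)
    | add s t hs ht =>
      intro a ha
      rw [map_add, add_mul]
      exact N.add_mem (hs _ ha) (ht _ ha)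
  rw [eq_top_iff]
  intro a _
  obtain ⟨t, rfl⟩ := hφ a
  simpa using key t 1 h1

/-- A bilinear form `B` on `V` with families `e`, `f` such that `∑ e i ⊗ f i` is the inverse of
`B` on either side, and `∑ B (e i) (f i) = -2`. It amounts to a symmetry
`x ⊗ y ↦ x ⊗ y + B x y • ∑ e i ⊗ f i` of rank 2 with central determinant. -/
structure RankTwoForm (k V ι : Type*) [Field k] [AddCommGroup V] [Module k V] [Fintype ι] where
  /-- the bilinear form -/
  B : V →ₗ[k] V →ₗ[k] k
  /-- the first legs of the inverse -/
  e : ι → V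
  /-- the second legs of the inverse -/
  f : ι → V
  sum_left : ∀ a, ∑ i, B (f i) a • e i = a
  sum_right : ∀ a, ∑ i, B a (e i) • f i = a
  trace : ∑ i, B (e i) (f i) = -2

namespace RankTwoForm

variable {k V ι : Type*} [Field k] [AddCommGroup V] [Module k V] [Fintype ι]
  (F : RankTwoForm k V ι)

section Contract

variable {N : Type*} [AddCommMonoid N] [Module k N]

theorem sum_left_map (g : V →ₗ[k] N) (a : V) : ∑ i, F.B (F.f i) a • g (F.e i) = g a := by
  conv_rhs => rw [← F.sum_left a]
  simp

theorem sum_right_map (g : V →ₗ[k] N) (a : V) : ∑ i, F.B a (F.e i) • g (F.f i) = g a := by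
  conv_rhs => rw [← F.sum_right a]
  simp

end Contract

/-- The relation `∑ e i * f i = 0`. -/
inductive SymRel : TensorAlgebra k V → TensorAlgebra k V → Prop
  | rel : SymRel (∑ i, TensorAlgebra.ι k (F.e i) * TensorAlgebra.ι k (F.f i)) 0

/-- The symmetric algebra of the symmetry attached to the form: `T(V)` modulo the single relation
`∑ e i * f i = 0`. -/
def SymAlg : Type _ := RingQuot F.SymRel

instance : Ring F.SymAlg := inferInstanceAs (Ring (RingQuot F.SymRel))

instance : Algebra k F.SymAlg := inferInstanceAs (Algebra k (RingQuot F.SymRel))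

/-- The projection of the tensor algebra onto `SymAlg`. -/
def mkHom : TensorAlgebra k V →ₐ[k] F.SymAlg := RingQuot.mkAlgHom k F.SymRel

theorem mkHom_surjective : Function.Surjective F.mkHom := RingQuot.mkAlgHom_surjective k F.SymRel

/-- The universal property of `SymAlg`. -/
def liftHom {A : Type*} [Ring A] [Algebra k A] (g : V →ₗ[k] A)
    (hg : ∑ i, g (F.e i) * g (F.f i) = 0) : F.SymAlg →ₐ[k] A :=
  RingQuot.liftAlgHom k ⟨TensorAlgebra.lift k g, by
    rintro _ _ ⟨⟩
    simpa using hg⟩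

/-- The canonical map `V → SymAlg`. -/
def gen : V →ₗ[k] F.SymAlg := F.mkHom.toLinearMap ∘ₗ TensorAlgebra.ι k

theorem gen_apply (x : V) : F.gen x = F.mkHom (TensorAlgebra.ι k x) := rfl

theorem liftHom_gen {A : Type*} [Ring A] [Algebra k A] (g : V →ₗ[k] A)
    (hg : ∑ i, g (F.e i) * g (F.f i) = 0) (x : V) : F.liftHom g hg (F.gen x) = g x := by
  change RingQuot.liftAlgHom k _ (RingQuot.mkAlgHom k F.SymRel _) = _
  rw [RingQuot.liftAlgHom_mkAlgHom_apply, TensorAlgebra.lift_ι_apply]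

theorem sum_gen_mul_gen : ∑ i, F.gen (F.e i) * F.gen (F.f i) = 0 := by
  have : F.mkHom _ = F.mkHom _ := RingQuot.mkAlgHom_rel k (SymRel.rel (F := F))
  simpa [gen_apply] using this

theorem sum_gen_mul_gen_mul (q : F.SymAlg) :
    ∑ i, F.gen (F.e i) * (F.gen (F.f i) * q) = 0 := by
  simp_rw [← mul_assoc, ← Finset.sum_mul, F.sum_gen_mul_gen, zero_mul]

theorem symAlg_induction {P : F.SymAlg → Prop} (h1 : P 1) (hadd : ∀ p q, P p → P q → P (p + q))
    (hsmul : ∀ (a : k) q, P q → P (a • q)) (hmul : ∀ x q, P q → P (F.gen x * q)) (q) : P q := by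
  let N : Submodule k F.SymAlg :=
    { carrier := {q | P q}
      add_mem' := fun {p q} hp hq => hadd p q hp hq
      zero_mem' := by simpa using hsmul 0 1 h1
      smul_mem' := fun a q hq => hsmul a q hq }
  have : N = ⊤ := eq_top_of_one_mem_of_mul_mem F.mkHom F.mkHom_surjective N h1 hmul
  exact this.ge (Submodule.mem_top (x := q))

/-- `d ↦ ∑ e i * d (f i)`; applied to the family of partial derivatives of `q` it gives the Euler
operator. -/
def eulerSum : (V →ₗ[k] F.SymAlg) →ₗ[k] F.SymAlg :=
  ∑ i, LinearMap.mulLeft k (F.gen (F.e i)) ∘ₗ LinearMap.applyₗ (F.f i)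

theorem eulerSum_apply (d : V →ₗ[k] F.SymAlg) :
    F.eulerSum d = ∑ i, F.gen (F.e i) * d (F.f i) := by
  simp [eulerSum]

/-- Multiplication by `y` on pairs `(q, d)`, where `d` stands for the family of partial
derivatives of `q`: the second component is what `∂_x (y q) = B x y (q + E q) + x ∂_y q` requires,
`E` being the Euler operator. -/
def jet : V →ₗ[k] Module.End k (F.SymAlg × (V →ₗ[k] F.SymAlg)) :=
  LinearMap.mk₂ k
    (fun y w => (F.gen y * w.1,
      (F.B.flip y).smulRight (w.1 + F.eulerSum w.2) + (LinearMap.mulRight k (w.2 y)) ∘ₗ F.gen))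
    (fun y z w => by
      ext <;> simp [add_mul, mul_add, add_smul]; abel)
    (fun a y w => by
      ext <;> simp [smul_smul])
    (fun y w z => by
      ext <;> simp [mul_add]; abel)
    (fun a y w => by
      ext <;> simp [smul_comm a])

theorem jet_fst (y : V) (w : F.SymAlg × (V →ₗ[k] F.SymAlg)) :
    (F.jet y w).1 = F.gen y * w.1 := rfl

theorem jet_snd (y : V) (w : F.SymAlg × (V →ₗ[k] F.SymAlg)) (x : V) :
    (F.jet y w).2 x = F.B x y • (w.1 + F.eulerSum w.2) + F.gen x * w.2 y := rfl

theorem eulerSum_jet (y : V) (w : F.SymAlg × (V →ₗ[k] F.SymAlg)) :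
    F.eulerSum (F.jet y w).2 = F.gen y * (w.1 + F.eulerSum w.2) := by
  rw [eulerSum_apply]
  simp_rw [jet_snd, mul_add, Finset.sum_add_distrib, F.sum_gen_mul_gen_mul, add_zero,
    mul_smul_comm, ← mul_add]
  exact F.sum_left_map (LinearMap.mulRight k _ ∘ₗ F.gen) y

/-- The rule for `∂_x (y q)` is compatible with the relation `∑ e i * f i = 0`. This is where
`∑ B (e i) (f i) = -2` is needed. -/
theorem sum_jet : ∑ i, F.jet (F.e i) * F.jet (F.f i) = 0 := by
  refine LinearMap.ext fun w => ?_
  rw [LinearMap.sum_apply]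
  refine Prod.ext ?_ (LinearMap.ext fun x => ?_)
  · rw [Prod.fst_sum]
    simpa [jet_fst] using F.sum_gen_mul_gen_mul w.1
  · rw [Prod.snd_sum, LinearMap.sum_apply]
    have h1 : ∑ i, F.B x (F.e i) • (F.gen (F.f i) * w.1 + F.gen (F.f i) * (w.1 + F.eulerSum w.2))
        = F.gen x * (w.1 + (w.1 + F.eulerSum w.2)) := by
      simp_rw [← mul_add]
      exact F.sum_right_map (LinearMap.mulRight k _ ∘ₗ F.gen) x
    have h2 : ∑ i, F.B (F.e i) (F.f i) • (F.gen x * (w.1 + F.eulerSum w.2))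
        = (-2 : k) • (F.gen x * (w.1 + F.eulerSum w.2)) := by
      rw [← Finset.sum_smul, F.trace]
    have h3 : ∑ i, F.gen x * (F.gen (F.e i) * w.2 (F.f i)) = F.gen x * F.eulerSum w.2 := by
      rw [← Finset.mul_sum, ← F.eulerSum_apply]
    simp_rw [Module.End.mul_apply, jet_snd, jet_fst, eulerSum_jet, mul_add (F.gen x),
      Finset.sum_add_distrib, h3, mul_smul_comm, h1, h2, mul_add]
    simp only [Prod.snd_zero, LinearMap.zero_apply]
    module

/-- The action of `SymAlg` on pairs `(q, d)`. Applied to `(1, 0)`, an element `q` gives `q` along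
with its partial derivatives. -/
def jetHom : F.SymAlg →ₐ[k] Module.End k (F.SymAlg × (V →ₗ[k] F.SymAlg)) :=
  F.liftHom (A := Module.End k (F.SymAlg × (V →ₗ[k] F.SymAlg))) F.jet (by simpa using F.sum_jet)

theorem jetHom_gen (x : V) : F.jetHom (F.gen x) = F.jet x := by
  rw [jetHom, liftHom_gen]

/-- The twisted partial derivative `∂_x` on `SymAlg`, with `∂_x y = B x y`. It is determined by
`∂_x 1 = 0` and the twisted Leibniz rule `der_gen_mul`. -/
def der : V →ₗ[k] Module.End k F.SymAlg :=
  LinearMap.mk₂ k (fun x q => (F.jetHom q (1, 0)).2 x)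
    (fun x y q => by simp) (fun a x q => by simp) (fun x p q => by simp) (fun a x q => by simp)

/-- The Euler operator `∑ e i ∂_{f i}`. -/
def euler : Module.End k F.SymAlg := ∑ i, LinearMap.mulLeft k (F.gen (F.e i)) * F.der (F.f i)

theorem euler_apply (q : F.SymAlg) :
    F.euler q = ∑ i, F.gen (F.e i) * F.der (F.f i) q := by
  simp [euler]

theorem jetHom_fst (q : F.SymAlg) : (F.jetHom q (1, 0)).1 = q := by
  induction q using F.symAlg_induction with
  | h1 => simp
  | hadd p q hp hq => simp [hp, hq]
  | hsmul a q hq => simp [hq]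
  | hmul x q hq => rw [map_mul, jetHom_gen, Module.End.mul_apply, jet_fst, hq]

theorem der_one (x : V) : F.der x 1 = 0 := by simp [der]

theorem der_gen_mul (x y : V) (q : F.SymAlg) :
    F.der x (F.gen y * q) = F.B x y • (q + F.euler q) + F.gen x * F.der y q := by
  change (F.jetHom (F.gen y * q) (1, 0)).2 x = _
  rw [map_mul, jetHom_gen, Module.End.mul_apply, jet_snd, jetHom_fst, eulerSum_apply, euler_apply]
  rfl

theorem euler_one : F.euler 1 = 0 := by simp [euler_apply, der_one]

theorem euler_gen_mul (y : V) (q : F.SymAlg) :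
    F.euler (F.gen y * q) = F.gen y * (q + F.euler q) := by
  rw [euler_apply]
  simp_rw [der_gen_mul, mul_add, Finset.sum_add_distrib, F.sum_gen_mul_gen_mul, add_zero,
    mul_smul_comm, ← mul_add]
  exact F.sum_left_map (LinearMap.mulRight k _ ∘ₗ F.gen) y

theorem euler_der (x : V) (q : F.SymAlg) :
    F.euler (F.der x q) = F.der x (F.euler q) - F.der x q := by
  induction q using F.symAlg_induction generalizing x with
  | h1 => simp [der_one, euler_one]
  | hadd p q hp hq => simp only [map_add, hp, hq]; abel
  | hsmul a q hq => simp only [map_smul, hq, smul_sub]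
  | hmul y q hq =>
    rw [euler_gen_mul, mul_add, map_add, add_sub_cancel_left, der_gen_mul, der_gen_mul, map_add,
      map_smul, map_add, euler_gen_mul, hq]
    simp

theorem sum_der_gen_mul (q : F.SymAlg) :
    ∑ i, F.der (F.e i) (F.gen (F.f i) * q) = -((2 : k) • q + F.euler q) := by
  simp_rw [der_gen_mul, Finset.sum_add_distrib, ← F.euler_apply, ← Finset.sum_smul, F.trace]
  module

/-- The partial derivatives satisfy the relation of the generators. -/
theorem sum_der_der (q : F.SymAlg) : ∑ i, F.der (F.e i) (F.der (F.f i) q) = 0 := by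
  induction q using F.symAlg_induction with
  | h1 => simp [der_one]
  | hadd p q hp hq => simp [Finset.sum_add_distrib, hp, hq]
  | hsmul a q hq => simp [← Finset.smul_sum, hq]
  | hmul y q _ =>
    have h := F.sum_left_map (F.der.flip (q + F.euler q)) y
    simp only [LinearMap.flip_apply] at h
    simp_rw [F.der_gen_mul _ y, map_add (F.der _), Finset.sum_add_distrib,
      F.sum_der_gen_mul, map_smul, h, euler_der, map_add]
    module

end RankTwoForm

/-! ### Homogeneous components and their dimensions -/

section Spectrum

variable {k A ι : Type*} [Field k] [AddCommGroup A] [Module k A]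

/-- Independence of eigenspaces shows that submodules which span the module, on which the
operator acts by distinct scalars, are the full eigenspaces. -/
theorem eigenspace_eq_of_iSup_eq_top {C : Module.End k A} {W : ι → Submodule k A} {l : ι → k}
    (hl : Function.Injective l) (hW : ∀ r, W r ≤ C.eigenspace (l r)) (htop : ⨆ r, W r = ⊤)
    (r : ι) : C.eigenspace (l r) = W r := by
  refine le_antisymm ?_ (hW r)
  have hle : (⊤ : Submodule k A) ≤ W r ⊔ ⨆ (μ) (_ : μ ≠ l r), C.eigenspace μ := by
    rw [← htop]
    refine iSup_le fun s => ?_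
    by_cases hs : s = r
    · subst hs
      exact le_sup_left
    · refine ((hW s).trans ?_).trans le_sup_right
      exact le_iSup₂ (f := fun μ (_ : μ ≠ l r) => C.eigenspace μ) (l s) (hl.ne hs)
  calc C.eigenspace (l r)
      ≤ (W r ⊔ ⨆ (μ) (_ : μ ≠ l r), C.eigenspace μ) ⊓ C.eigenspace (l r) :=
        le_inf (le_top.trans hle) le_rfl
    _ = W r ⊔ (⨆ (μ) (_ : μ ≠ l r), C.eigenspace μ) ⊓ C.eigenspace (l r) :=
        sup_inf_assoc_of_le _ (hW r)
    _ = W r := by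
        have h := (C.eigenspaces_iSupIndep (l r)).eq_bot
        rw [inf_comm] at h
        rw [h, sup_bot_eq]

theorem eigenspace_eq_bot_of_iSup_eq_top {C : Module.End k A} {W : ι → Submodule k A} {l : ι → k}
    (hW : ∀ r, W r ≤ C.eigenspace (l r)) (htop : ⨆ r, W r = ⊤) {μ : k} (hμ : ∀ r, l r ≠ μ) :
    C.eigenspace μ = ⊥ := by
  have hle : (⊤ : Submodule k A) ≤ ⨆ (ν) (_ : ν ≠ μ), C.eigenspace ν := by
    rw [← htop]
    exact iSup_le fun s => (hW s).trans (le_iSup₂_of_le (l s) (hμ s) le_rfl)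
  have := (C.eigenspaces_iSupIndep μ).eq_bot
  rwa [inf_eq_left.2 (le_top.trans hle)] at this

end Spectrum

namespace RankTwoForm

variable {k V ι : Type*} [Field k] [AddCommGroup V] [Module k V] [Fintype ι]
  (F : RankTwoForm k V ι)

/-- The elements of degree `c` of `SymAlg`: an eigenspace of the Euler operator. -/
def deg (c : k) : Submodule k F.SymAlg := F.euler.eigenspace c

variable {F}

theorem mem_deg {c : k} {q : F.SymAlg} : q ∈ F.deg c ↔ F.euler q = c • q :=
  Module.End.mem_eigenspace_iff

theorem one_mem_deg : (1 : F.SymAlg) ∈ F.deg 0 := by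
  simp [mem_deg, euler_one]

theorem gen_mul_mem_deg {c : k} {q : F.SymAlg} (hq : q ∈ F.deg c) (x : V) :
    F.gen x * q ∈ F.deg (c + 1) := by
  rw [mem_deg] at hq ⊢
  rw [euler_gen_mul, hq, mul_add, mul_smul_comm, add_smul, one_smul, add_comm]

theorem der_mem_deg {c : k} {q : F.SymAlg} (hq : q ∈ F.deg c) (x : V) :
    F.der x q ∈ F.deg (c - 1) := by
  rw [mem_deg] at hq ⊢
  rw [euler_der, hq, map_smul]
  module

theorem der_gen_mul_of_mem {c : k} {q : F.SymAlg} (hq : q ∈ F.deg c) (x y : V) :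
    F.der x (F.gen y * q) = ((c + 1) * F.B x y) • q + F.gen x * F.der y q := by
  rw [der_gen_mul, mem_deg.1 hq]
  module

theorem sum_gen_mul_der_of_mem {c : k} {q : F.SymAlg} (hq : q ∈ F.deg c) :
    ∑ i, F.gen (F.e i) * F.der (F.f i) q = c • q := by
  rw [← euler_apply, mem_deg.1 hq]

theorem sum_der_gen_mul_of_mem {c : k} {q : F.SymAlg} (hq : q ∈ F.deg c) :
    ∑ i, F.der (F.e i) (F.gen (F.f i) * q) = -(c + 2) • q := by
  rw [sum_der_gen_mul, mem_deg.1 hq]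
  module

variable (F) in
/-- The homogeneous components of `SymAlg`, with the scalars in place of the whole kernel of the
Euler operator. As these subspaces span, the two coincide in characteristic zero. -/
def homComponent : ℕ → Submodule k F.SymAlg
  | 0 => k ∙ 1
  | m + 1 => F.deg ((m + 1 : ℕ) : k)

theorem homComponent_le (m : ℕ) : F.homComponent m ≤ F.deg (m : k) := by
  cases m with
  | zero =>
    rw [homComponent, Submodule.span_singleton_le_iff_mem, Nat.cast_zero]
    exact one_mem_deg
  | succ m => exact le_rfl

variable (F) in
theorem iSup_homComponent : ⨆ m, F.homComponent m = ⊤ := by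
  refine eq_top_of_one_mem_of_mul_mem F.mkHom F.mkHom_surjective _ ?_ fun x q hq => ?_
  · exact Submodule.mem_iSup_of_mem 0 (Submodule.mem_span_singleton_self _)
  · rw [← gen_apply]
    induction hq using Submodule.iSup_induction' with
    | mem m q hq =>
      refine Submodule.mem_iSup_of_mem (m + 1) ?_
      have := gen_mul_mem_deg (homComponent_le m hq) x
      rw [homComponent]
      exact_mod_cast this
    | zero => simp
    | add p q _ _ hp hq => rw [mul_add]; exact Submodule.add_mem _ hp hq

variable (F) in
theorem iSup_deg : ⨆ m : ℕ, F.deg (m : k) = ⊤ :=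
  top_le_iff.1 ((iSup_homComponent F).ge.trans (iSup_mono homComponent_le))

section CharZero

theorem deg_eq_bot {c : k} (hc : ∀ m : ℕ, (m : k) ≠ c) : F.deg c = ⊥ :=
  eigenspace_eq_bot_of_iSup_eq_top (fun _ => le_rfl) (iSup_deg F) hc

variable [CharZero k]

theorem deg_zero : F.deg 0 = k ∙ 1 := by
  have := eigenspace_eq_of_iSup_eq_top (Nat.cast_injective (R := k)) homComponent_le
    (iSup_homComponent F) 0
  simpa [homComponent, deg] using this

theorem deg_neg_one : F.deg (-1) = ⊥ := by
  refine deg_eq_bot fun m hm => ?_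
  have : ((m + 1 : ℕ) : k) = 0 := by push_cast; rw [hm]; ring
  exact Nat.succ_ne_zero m (Nat.cast_eq_zero.1 this)

variable (F) in
/-- Linear maps on the homogeneous components glue to a linear map on `SymAlg`. -/
theorem exists_glue {A : Type*} [AddCommGroup A] [Module k A] (g : ℕ → F.SymAlg →ₗ[k] A) :
    ∃ G : F.SymAlg →ₗ[k] A, ∀ m : ℕ, ∀ q ∈ F.deg (m : k), G q = g m q := by
  have hI : DirectSum.IsInternal fun m : ℕ => F.deg (m : k) :=
    DirectSum.isInternal_submodule_of_iSupIndep_of_iSup_eq_top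
      (F.euler.eigenspaces_iSupIndep.comp Nat.cast_injective) (iSup_deg F)
  let E := LinearEquiv.ofBijective (DirectSum.coeLinearMap fun m : ℕ => F.deg (m : k)) hI
  refine ⟨DirectSum.toModule k ℕ A (fun m => g m ∘ₗ (F.deg (m : k)).subtype) ∘ₗ
    E.symm.toLinearMap, fun m q hq => ?_⟩
  have hE : E.symm q = DirectSum.lof k ℕ (fun m : ℕ => F.deg (m : k)) m ⟨q, hq⟩ := by
    rw [LinearEquiv.symm_apply_eq]
    exact (DirectSum.coeLinearMap_lof (fun m : ℕ => F.deg (m : k)) m ⟨q, hq⟩).symm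
  simp [hE]

end CharZero

section Augmentation

variable (F) in
/-- The augmentation of `SymAlg`, which kills `V`. -/
def aug : F.SymAlg →ₐ[k] k := F.liftHom 0 (by simp)

instance : Nontrivial F.SymAlg := F.aug.toRingHom.domain_nontrivial

end Augmentation

section Dimension

variable (F) in
/-- The map `x ⊗ q ↦ (∂_x q, x q)` from `V ⊗ Q_{c+1}` to `Q_c × Q_{c+2}`, for the homogeneous
components `Q_c` of `SymAlg`. Here `V ⊗ Q_{c+1}` is written as a power of `Q_{c+1}` with the help
of the family `e`. -/
def degMap (c : k) : (ι → F.deg (c + 1)) →ₗ[k] F.deg c × F.deg (c + 2) :=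
  LinearMap.prod
    (LinearMap.codRestrict _
      (∑ i, F.der (F.e i) ∘ₗ (F.deg (c + 1)).subtype ∘ₗ LinearMap.proj i) fun q => by
        rw [LinearMap.sum_apply]
        exact Submodule.sum_mem _ fun i _ => by simpa using der_mem_deg (q i).2 (F.e i))
    (LinearMap.codRestrict _
      (∑ i, LinearMap.mulLeft k (F.gen (F.e i)) ∘ₗ (F.deg (c + 1)).subtype ∘ₗ
        LinearMap.proj i) fun q => by
        rw [LinearMap.sum_apply]
        refine Submodule.sum_mem _ fun i _ => ?_
        have := gen_mul_mem_deg (q i).2 (F.e i)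
        rwa [show c + 1 + 1 = c + 2 by ring] at this)

theorem degMap_fst (c : k) (q : ι → F.deg (c + 1)) :
    ((F.degMap c q).1 : F.SymAlg) = ∑ i, F.der (F.e i) (q i) := by
  simp [degMap]

theorem degMap_snd (c : k) (q : ι → F.deg (c + 1)) :
    ((F.degMap c q).2 : F.SymAlg) = ∑ i, F.gen (F.e i) * (q i) := by
  simp [degMap]

variable [DecidableEq ι]

/-- `V ⊗ Q_{c+1}` is the sum of `Q_c` and `Q_{c+2}`, by means of `x ⊗ q ↦ (∂_x q, x q)`. -/
theorem degMap_bijective (hdual : ∀ i j, F.B (F.f i) (F.e j) = if i = j then 1 else 0) {c : k}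
    (hc : c + 2 ≠ 0) : Function.Bijective (F.degMap c) := by
  constructor
  · -- `q i` is recovered as `(c + 2)⁻¹ (∂_{f i} r₂ - f i r₁)` from the image `(r₁, r₂)` of `q`
    refine (injective_iff_map_eq_zero _).2 fun q hq => funext fun i => Subtype.ext ?_
    have h1 := degMap_fst c q
    have h2 := degMap_snd c q
    rw [hq] at h1 h2
    have h : ∀ j, F.der (F.f i) (F.gen (F.e j) * (q j : F.SymAlg))
        = (if i = j then (c + 2) • (q j : F.SymAlg) else 0)
          + F.gen (F.f i) * F.der (F.e j) (q j) := fun j => by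
      rw [der_gen_mul_of_mem (q j).2, hdual]
      split_ifs
      · rw [mul_one, show c + 1 + 1 = c + 2 by ring]
      · rw [mul_zero, zero_smul]
    have h3 := congrArg (F.der (F.f i)) h2
    simp only [map_sum, h, Finset.sum_add_distrib, ← Finset.mul_sum, ← h1] at h3
    simpa [hc] using h3.symm
  · -- the preimage is given by the same formula
    intro r
    have h1 := sum_gen_mul_der_of_mem r.2.2
    have h2 := sum_der_gen_mul_of_mem r.1.2
    have h3 := F.sum_gen_mul_gen_mul (r.1 : F.SymAlg)
    have h4 := F.sum_der_der (r.2 : F.SymAlg)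
    have h5 : ∀ i, F.der (F.f i) r.2 - F.gen (F.f i) * r.1 ∈ F.deg (c + 1) := fun i => by
      have := der_mem_deg r.2.2 (F.f i)
      rw [show c + 2 - 1 = c + 1 by ring] at this
      exact Submodule.sub_mem _ this (gen_mul_mem_deg r.1.2 (F.f i))
    refine ⟨fun i => (c + 2)⁻¹ • ⟨_, h5 i⟩, Prod.ext (Subtype.ext ?_) (Subtype.ext ?_)⟩
    · rw [degMap_fst]
      simp only [Submodule.coe_smul, map_smul, map_sub, ← Finset.smul_sum,
        Finset.sum_sub_distrib, h2, h4, zero_sub]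
      rw [neg_smul, neg_neg, inv_smul_smul₀ hc]
    · rw [degMap_snd]
      simp only [Submodule.coe_smul, mul_smul_comm, mul_sub, ← Finset.smul_sum,
        Finset.sum_sub_distrib, h1, h3, sub_zero]
      rw [inv_smul_smul₀ hc]

/-- The linear equivalence given by `degMap`. -/
def degEquiv (hdual : ∀ i j, F.B (F.f i) (F.e j) = if i = j then 1 else 0) (c : k)
    (hc : c + 2 ≠ 0) : (ι → F.deg (c + 1)) ≃ₗ[k] F.deg c × F.deg (c + 2) :=
  LinearEquiv.ofBijective (F.degMap c) (degMap_bijective hdual hc)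

variable [CharZero k]

omit [DecidableEq ι] in
theorem finrank_deg_zero : Module.finrank k (F.deg (0 : k)) = 1 := by
  rw [deg_zero]
  exact finrank_span_singleton one_ne_zero

/-- Finiteness goes up the degrees, since `Q_{c+2}` is a quotient of a power of `Q_{c+1}`. -/
theorem finite_deg (hdual : ∀ i j, F.B (F.f i) (F.e j) = if i = j then 1 else 0) (m : ℕ) :
    Module.Finite k (F.deg (m : k)) ∧ Module.Finite k (F.deg ((m : k) + 1)) := by
  have step : ∀ c : k, c + 2 ≠ 0 → Module.Finite k (F.deg (c + 1)) →
      Module.Finite k (F.deg (c + 2)) := fun c hc h =>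
    Module.Finite.of_surjective (LinearMap.snd k _ _ ∘ₗ (degEquiv hdual c hc).toLinearMap)
      (Prod.snd_surjective.comp (degEquiv hdual c hc).surjective)
  induction m with
  | zero =>
    have h0 : Module.Finite k (F.deg (0 : k)) := by rw [deg_zero]; infer_instance
    have h1 := step (-1) (by norm_num) (by rwa [neg_add_cancel])
    rw [show (-1 : k) + 2 = 0 + 1 by ring] at h1
    rw [Nat.cast_zero]
    exact ⟨h0, h1⟩
  | succ m ih =>
    rw [Nat.cast_succ]
    refine ⟨ih.2, ?_⟩
    have := step m (by exact_mod_cast Nat.succ_ne_zero (m + 1)) ih.2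
    rwa [show (m : k) + 1 + 1 = m + 2 by ring]

/-- The case `c = -1` of `degEquiv`: `V ⊗ Q_0` is `Q_1`, as `Q_{-1} = 0`. -/
theorem finrank_deg_one (hdual : ∀ i j, F.B (F.f i) (F.e j) = if i = j then 1 else 0) :
    Module.finrank k (F.deg (1 : k)) = Fintype.card ι := by
  have E := degEquiv hdual (-1 : k) (by norm_num)
  rw [neg_add_cancel, show (-1 : k) + 2 = 1 by ring, deg_neg_one] at E
  have := (finite_deg hdual 0).1
  have := (finite_deg hdual 0).2
  rw [Nat.cast_zero] at *
  rw [zero_add] at this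
  have h := E.finrank_eq
  rw [Module.finrank_pi_fintype, Module.finrank_prod] at h
  simpa [finrank_deg_zero] using h.symm

theorem finrank_deg_add_two (hdual : ∀ i j, F.B (F.f i) (F.e j) = if i = j then 1 else 0)
    (m : ℕ) : Module.finrank k (F.deg (m : k)) + Module.finrank k (F.deg ((m + 2 : ℕ) : k))
      = Fintype.card ι * Module.finrank k (F.deg ((m + 1 : ℕ) : k)) := by
  have E := degEquiv hdual (m : k) (by exact_mod_cast Nat.succ_ne_zero (m + 1))
  have := (finite_deg hdual m).1
  have := (finite_deg hdual m).2
  have := (finite_deg hdual (m + 1)).2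
  rw [show ((m + 1 : ℕ) : k) + 1 = m + 2 by push_cast; ring] at this
  have h := E.finrank_eq
  rw [Module.finrank_pi_fintype, Module.finrank_prod] at h
  rw [show ((m + 2 : ℕ) : k) = m + 2 by push_cast; ring, Nat.cast_succ]
  simpa using h.symm

end Dimension

end RankTwoForm

/-! ### Operators of multiplication and of the adjoint action on the symmetric algebra -/

namespace RankTwoForm

variable {k V ι : Type*} [Field k] [CharZero k] [AddCommGroup V] [Module k V] [Fintype ι]
  (F : RankTwoForm k V ι)

theorem deg_eq_bot_of_neg {m : ℤ} (hm : m < 0) : F.deg (m : k) = ⊥ := by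
  refine deg_eq_bot fun j hj => ?_
  have : (j : ℤ) = m := by exact_mod_cast hj
  omega

/-- The operator acting as the scalar `a m` on the component of degree `m`. -/
def scaleOp (a : k → k) : Module.End k F.SymAlg :=
  (exists_glue F fun m => a m • LinearMap.id).choose

variable {F} in
theorem scaleOp_apply (a : k → k) {m : ℤ} {q : F.SymAlg} (hq : q ∈ F.deg (m : k)) :
    F.scaleOp a q = a m • q := by
  rcases lt_or_ge m 0 with hm | hm
  · rw [F.deg_eq_bot_of_neg hm, Submodule.mem_bot] at hq
    rw [hq, map_zero, smul_zero]
  · lift m to ℕ using hm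
    rw [Int.cast_natCast] at hq ⊢
    exact (exists_glue F fun m => a m • LinearMap.id).choose_spec m q hq

/-- The coefficient of the lowering part of the action of the generators of the hyperboloid. It is
used in even degrees `m` only, where the denominator does not vanish. -/
def lowCoeff (c m : k) : k := -c / (2 * (m - 1) * (m + 1))

/-- The action of the generator `x ⊗ y` of the hyperboloid on the symmetric algebra: the
multiplication by `x y` plus a multiple, depending on the degree, of `∂_x ∂_y`. -/
def mulOp (c : k) : V →ₗ[k] V →ₗ[k] Module.End k F.SymAlg :=
  LinearMap.mk₂ k
    (fun x y => LinearMap.mulLeft k (F.gen x) * LinearMap.mulLeft k (F.gen y) +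
      F.der x * F.der y * F.scaleOp (lowCoeff c))
    (fun x x' y => by
      refine LinearMap.ext fun q => ?_
      simp [add_mul]; abel)
    (fun a x y => by
      refine LinearMap.ext fun q => ?_
      simp)
    (fun x y y' => by
      refine LinearMap.ext fun q => ?_
      simp [add_mul, mul_add]; abel)
    (fun a x y => by
      refine LinearMap.ext fun q => ?_
      simp)

/-- The adjoint action of the operator `x ⊗ y` on the symmetric algebra:
`x ∂_y`, corrected by a multiple of the Euler operator so that `∑ e i ⊗ f i` acts by zero. -/
def adOp : V →ₗ[k] V →ₗ[k] Module.End k F.SymAlg :=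
  LinearMap.mk₂ k
    (fun x y => LinearMap.mulLeft k (F.gen x) * F.der y + ((2 : k)⁻¹ * F.B x y) • F.euler)
    (fun x x' y => by
      refine LinearMap.ext fun q => ?_
      simp [add_mul, mul_add, add_smul]; abel)
    (fun a x y => by
      refine LinearMap.ext fun q => ?_
      simp [smul_smul, mul_left_comm])
    (fun x y y' => by
      refine LinearMap.ext fun q => ?_
      simp [mul_add, add_smul]; abel)
    (fun a x y => by
      refine LinearMap.ext fun q => ?_
      simp [smul_smul, mul_left_comm])

variable {F}

theorem mulOp_eq (c : k) (x y : V) (q : F.SymAlg) : F.mulOp c x y q =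
    F.gen x * (F.gen y * q) + F.der x (F.der y (F.scaleOp (lowCoeff c) q)) := rfl

theorem mulOp_apply (c : k) (x y : V) {m : ℤ} {q : F.SymAlg} (hq : q ∈ F.deg (m : k)) :
    F.mulOp c x y q = F.gen x * (F.gen y * q) + lowCoeff c m • F.der x (F.der y q) := by
  rw [mulOp_eq, scaleOp_apply _ hq, map_smul, map_smul]

omit [CharZero k] in
theorem adOp_eq (x y : V) (q : F.SymAlg) : F.adOp x y q =
    F.gen x * F.der y q + ((2 : k)⁻¹ * F.B x y) • F.euler q := rfl

theorem adOp_apply (x y : V) {m : k} {q : F.SymAlg} (hq : q ∈ F.deg m) :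
    F.adOp x y q = F.gen x * F.der y q + ((2 : k)⁻¹ * m * F.B x y) • q := by
  rw [adOp_eq, mem_deg.1 hq, smul_smul]
  congr 2
  ring

omit [CharZero k] in
theorem mul_mul_mem_deg {m : ℤ} {q : F.SymAlg} (hq : q ∈ F.deg (m : k)) (x y : V) :
    F.gen x * (F.gen y * q) ∈ F.deg ((m + 2 : ℤ) : k) := by
  have := gen_mul_mem_deg (gen_mul_mem_deg hq y) x
  rwa [show ((m + 2 : ℤ) : k) = m + 1 + 1 by push_cast; ring]

omit [CharZero k] in
theorem der_der_mem_deg {m : ℤ} {q : F.SymAlg} (hq : q ∈ F.deg (m : k)) (x y : V) :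
    F.der x (F.der y q) ∈ F.deg ((m - 2 : ℤ) : k) := by
  have := der_mem_deg (der_mem_deg hq y) x
  rwa [show ((m - 2 : ℤ) : k) = m - 1 - 1 by push_cast; ring]

theorem adOp_mem_deg {m : k} {q : F.SymAlg} (hq : q ∈ F.deg m) (x y : V) :
    F.adOp x y q ∈ F.deg m := by
  rw [adOp_apply x y hq]
  have := gen_mul_mem_deg (der_mem_deg hq y) x
  rw [sub_add_cancel] at this
  exact Submodule.add_mem _ this (Submodule.smul_mem _ _ hq)

theorem sum_mulOp_e_f (c : k) (q : F.SymAlg) : ∑ i, F.mulOp c (F.e i) (F.f i) q = 0 := by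
  simp_rw [mulOp_eq, Finset.sum_add_distrib, F.sum_gen_mul_gen_mul, F.sum_der_der, add_zero]

theorem sum_adOp_e_f (q : F.SymAlg) : ∑ i, F.adOp (F.e i) (F.f i) q = 0 := by
  simp_rw [adOp_eq, Finset.sum_add_distrib, ← F.euler_apply, ← Finset.sum_smul, ← Finset.mul_sum,
    F.trace]
  module

theorem two_mul_cast_add_ne_zero (r j : ℤ) : (((2 * r : ℤ) : k) + (2 * j + 1)) ≠ 0 := by
  have : (2 * r + (2 * j + 1) : ℤ) ≠ 0 := by omega
  exact_mod_cast this

theorem lowCoeff_mul (c : k) (r : ℤ) :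
    (((2 * r : ℤ) : k) - 1) * lowCoeff c ((2 * r : ℤ) : k) = -c / (2 * (((2 * r : ℤ) : k) + 1)) := by
  have h1 := two_mul_cast_add_ne_zero (k := k) r (-1)
  have h2 := two_mul_cast_add_ne_zero (k := k) r 0
  have h3 : ((2 * r : ℤ) : k) - 1 ≠ 0 := by
    intro h
    apply h1
    rw [← h]
    push_cast
    ring
  have h4 : ((2 * r : ℤ) : k) + 1 ≠ 0 := by simpa using h2
  rw [lowCoeff]
  field_simp

theorem lowCoeff_add_two_mul (c : k) (r : ℤ) : (((2 * r : ℤ) : k) + 3) *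
    lowCoeff c ((2 * r + 2 : ℤ) : k) = -c / (2 * (((2 * r : ℤ) : k) + 1)) := by
  have h1 := two_mul_cast_add_ne_zero (k := k) r 1
  have h2 := two_mul_cast_add_ne_zero (k := k) r 0
  have h3 : ((2 * r : ℤ) : k) + 3 ≠ 0 := by
    intro h
    apply h1
    rw [← h]
    push_cast
    ring
  have h4 : ((2 * r : ℤ) : k) + 1 ≠ 0 := by simpa using h2
  rw [lowCoeff, show ((2 * r + 2 : ℤ) : k) - 1 = ((2 * r : ℤ) : k) + 1 by push_cast; ring,
    show ((2 * r + 2 : ℤ) : k) + 1 = ((2 * r : ℤ) : k) + 3 by push_cast; ring]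
  field_simp

/-- The operators `mulOp` satisfy the relations of the hyperboloid on even degrees. The
coefficients `lowCoeff` are chosen so that the terms `x ∂_y q` cancel and the multiple of
`B x y • q` that remains does not depend on the degree. -/
theorem sum_mulOp_mulOp (c : k) (x y : V) {r : ℤ} {q : F.SymAlg}
    (hq : q ∈ F.deg ((2 * r : ℤ) : k)) :
    ∑ i, F.mulOp c x (F.e i) (F.mulOp c (F.f i) y q) = (c / 2 * F.B x y) • q := by
  have h1 := sum_der_gen_mul_of_mem (gen_mul_mem_deg hq y)
  have h2 := sum_gen_mul_der_of_mem (der_mem_deg hq y)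
  have h : ∀ i, F.mulOp c x (F.e i) (F.mulOp c (F.f i) y q) =
      (F.gen x * (F.gen (F.e i) * (F.gen (F.f i) * (F.gen y * q))) +
        lowCoeff c ((2 * r + 2 : ℤ) : k) • F.der x (F.der (F.e i)
          (F.gen (F.f i) * (F.gen y * q)))) +
      lowCoeff c ((2 * r : ℤ) : k) • (F.gen x * (F.gen (F.e i) * (F.der (F.f i) (F.der y q))) +
        lowCoeff c ((2 * r - 2 : ℤ) : k) • F.der x (F.der (F.e i) (F.der (F.f i) (F.der y q)))) := by
    intro i
    rw [mulOp_apply c (F.f i) y hq, map_add, map_smul, mulOp_apply c x _ (mul_mul_mem_deg hq _ _),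
      mulOp_apply c x _ (der_der_mem_deg hq _ _)]
  simp_rw [h, Finset.sum_add_distrib, ← Finset.smul_sum, Finset.sum_add_distrib,
    ← Finset.smul_sum, ← map_sum, ← Finset.mul_sum, F.sum_gen_mul_gen_mul, h1, h2, F.sum_der_der,
    map_smul, der_gen_mul_of_mem hq, map_zero, smul_zero, mul_zero, add_zero, zero_add,
    mul_smul_comm, smul_smul, smul_add, smul_smul]
  have e1 : lowCoeff c ((2 * r + 2 : ℤ) : k) * -(((2 * r : ℤ) : k) + 1 + 2) =
      c / (2 * (((2 * r : ℤ) : k) + 1)) := by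
    have := lowCoeff_add_two_mul c r
    linear_combination -this
  have e2 : lowCoeff c ((2 * r : ℤ) : k) * (((2 * r : ℤ) : k) - 1) =
      -(c / (2 * (((2 * r : ℤ) : k) + 1))) := by
    have := lowCoeff_mul c r
    linear_combination this
  have e3 : c / (2 * (((2 * r : ℤ) : k) + 1)) * ((((2 * r : ℤ) : k) + 1) * F.B x y) =
      c / 2 * F.B x y := by
    have h2 := two_mul_cast_add_ne_zero (k := k) r 0
    have h4 : ((2 * r : ℤ) : k) + 1 ≠ 0 := by simpa using h2
    field_simp
  rw [e1, e2, e3]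
  module

theorem sum_mulOp_adOp (c : k) (x y : V) {m : ℤ} {q : F.SymAlg} (hq : q ∈ F.deg (m : k)) :
    ∑ i, F.mulOp c x (F.e i) (F.adOp (F.f i) y q) = (2⁻¹ * m : k) • (F.gen x * (F.gen y * q)) -
      (lowCoeff c m * (2⁻¹ * m + 1)) • F.der x (F.der y q) := by
  have h1 := sum_der_gen_mul_of_mem (der_mem_deg hq y)
  have h2 := F.sum_left_map (LinearMap.mulLeft k (F.gen x) ∘ₗ LinearMap.mulRight k q ∘ₗ F.gen) y
  have h3 := F.sum_left_map (F.der x ∘ₗ F.der.flip q) y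
  simp only [LinearMap.comp_apply, LinearMap.mulLeft_apply, LinearMap.mulRight_apply,
    LinearMap.flip_apply] at h2 h3
  have h : ∀ i, F.mulOp c x (F.e i) (F.adOp (F.f i) y q) =
      F.gen x * (F.gen (F.e i) * (F.gen (F.f i) * F.der y q)) +
      lowCoeff c m • F.der x (F.der (F.e i) (F.gen (F.f i) * F.der y q)) +
      ((2⁻¹ * m : k) • (F.B (F.f i) y • (F.gen x * (F.gen (F.e i) * q))) +
      (lowCoeff c m * (2⁻¹ * m)) • (F.B (F.f i) y • F.der x (F.der (F.e i) q))) := by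
    intro i
    rw [mulOp_apply c x _ (adOp_mem_deg hq _ _), adOp_apply _ _ hq]
    simp only [mul_add, map_add, mul_smul_comm, map_smul]
    module
  simp_rw [h, Finset.sum_add_distrib, ← Finset.smul_sum, ← map_sum, ← Finset.mul_sum,
    F.sum_gen_mul_gen_mul, h1, h2, h3, map_smul, mul_zero]
  module

theorem sum_sum_mulOp_adOp (c : k) {m : ℤ} {q : F.SymAlg} (hq : q ∈ F.deg (m : k)) :
    ∑ j, ∑ i, F.mulOp c (F.e j) (F.e i) (F.adOp (F.f i) (F.f j) q) = 0 := by
  simp_rw [sum_mulOp_adOp c _ _ hq, Finset.sum_sub_distrib, ← Finset.smul_sum,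
    F.sum_gen_mul_gen_mul, F.sum_der_der, smul_zero, sub_zero]

/-- The twisted Leibniz rule for the operators `adOp` and `mulOp`. On the right are the bracket of
`x ⊗ y` and `z ⊗ w`, and their twist without the multiples of `∑ e j ⊗ e i ⊗ f i ⊗ f j`, which
acts by zero. -/
theorem adOp_mulOp (c : k) (x y z w : V) {m : ℤ} {q : F.SymAlg} (hq : q ∈ F.deg (m : k)) :
    F.adOp x y (F.mulOp c z w q) = (2 * F.B y z) • F.mulOp c x w q + F.B x y • F.mulOp c z w q +
      F.B z w • F.mulOp c x y q + (F.mulOp c x y (F.adOp z w q) +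
      (2 * F.B y z) • ∑ i, F.mulOp c x (F.e i) (F.adOp (F.f i) w q) +
      F.B x y • ∑ i, F.mulOp c z (F.e i) (F.adOp (F.f i) w q) +
      F.B z w • ∑ i, F.mulOp c x (F.e i) (F.adOp (F.f i) y q)) := by
  simp_rw [sum_mulOp_adOp c _ _ hq, mulOp_apply c x y (adOp_mem_deg hq z w),
    mulOp_apply c _ _ hq, map_add, map_smul]
  rw [adOp_apply x y (mul_mul_mem_deg hq z w), adOp_apply x y (der_der_mem_deg hq z w),
    adOp_apply z w hq]
  have h1 := der_gen_mul_of_mem (gen_mul_mem_deg hq w) y z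
  have h2 := der_gen_mul_of_mem hq z w
  have h3 := der_gen_mul_of_mem (der_mem_deg hq w) y z
  have h4 := der_gen_mul_of_mem (der_mem_deg (der_mem_deg hq w) z) x y
  simp only [h1, h2, h3, h4, map_add, map_smul, mul_add, mul_smul_comm]
  push_cast
  module

theorem sum_adOp_adOp (x y : V) {m : k} {q : F.SymAlg} (hq : q ∈ F.deg m) :
    ∑ i, F.adOp x (F.e i) (F.adOp (F.f i) y q) =
      -(F.gen x * F.der y q) + (4⁻¹ * m ^ 2 * F.B x y) • q := by
  have h1 := sum_der_gen_mul_of_mem (der_mem_deg hq y)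
  have h2 := F.sum_left_map (LinearMap.mulLeft k (F.gen x) ∘ₗ F.der.flip q) y
  have h3 := F.sum_right_map (LinearMap.mulRight k (F.der y q) ∘ₗ F.gen) x
  have h4 := F.sum_right_map (LinearMap.toSpanSingleton k _ q ∘ₗ F.B.flip y) x
  simp only [LinearMap.comp_apply, LinearMap.mulLeft_apply, LinearMap.mulRight_apply,
    LinearMap.flip_apply, LinearMap.toSpanSingleton_apply] at h2 h3 h4
  have h : ∀ i, F.adOp x (F.e i) (F.adOp (F.f i) y q) =
      F.gen x * (F.der (F.e i) (F.gen (F.f i) * F.der y q)) +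
      (2⁻¹ * m) • (F.B (F.f i) y • (F.gen x * F.der (F.e i) q)) +
      ((2⁻¹ * m) • (F.B x (F.e i) • (F.gen (F.f i) * F.der y q)) +
      (4⁻¹ * m ^ 2) • (F.B x (F.e i) • (F.B (F.f i) y • q))) := by
    intro i
    rw [adOp_apply _ _ (adOp_mem_deg hq _ _), adOp_apply _ _ hq]
    simp only [mul_add, map_add, mul_smul_comm, map_smul]
    module
  simp_rw [h, Finset.sum_add_distrib, ← Finset.smul_sum, ← Finset.mul_sum, h1, h2, h3, h4,
    mul_smul_comm]
  module

/-- The Casimir operator, which is minus the sum on the left by `casimirTensor_eq`, acts on the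
symmetric algebra as `E (E + 2) / 2`, where `E` is the Euler operator. -/
theorem sum_sum_adOp_adOp {m : k} {q : F.SymAlg} (hq : q ∈ F.deg m) :
    ∑ j, ∑ i, F.adOp (F.e j) (F.e i) (F.adOp (F.f i) (F.f j) q) =
      -(2⁻¹ * m * (m + 2)) • q := by
  simp_rw [sum_adOp_adOp _ _ hq, Finset.sum_add_distrib, Finset.sum_neg_distrib,
    ← Finset.sum_smul, ← Finset.mul_sum, F.trace, sum_gen_mul_der_of_mem hq]
  module

end RankTwoForm

/-! ### The even part of the symmetric algebra and its identification with the hyperboloid -/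

namespace RankTwoForm

variable {k V ι : Type*} [Field k] [CharZero k] [AddCommGroup V] [Module k V] [Fintype ι]
  (F : RankTwoForm k V ι)

/-- The even part of the symmetric algebra. -/
def evenPart : Submodule k F.SymAlg := ⨆ r : ℕ, F.deg ((2 * r : ℤ) : k)

variable {F}

theorem mem_evenPart {r : ℤ} {q : F.SymAlg} (hq : q ∈ F.deg ((2 * r : ℤ) : k)) :
    q ∈ F.evenPart := by
  rcases lt_or_ge r 0 with hr | hr
  · rw [F.deg_eq_bot_of_neg (by omega), Submodule.mem_bot] at hq
    rw [hq]
    exact Submodule.zero_mem _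
  · lift r to ℕ using hr
    exact Submodule.mem_iSup_of_mem r hq

theorem evenPart_induction {P : ∀ q : F.SymAlg, q ∈ F.evenPart → Prop}
    (h0 : P 0 (Submodule.zero_mem _))
    (hadd : ∀ p q hp hq, P p hp → P q hq → P (p + q) (Submodule.add_mem _ hp hq))
    (h : ∀ r : ℕ, ∀ q (hq : q ∈ F.deg ((2 * r : ℤ) : k)), P q (mem_evenPart hq)) {q : F.SymAlg}
    (hq : q ∈ F.evenPart) : P q hq :=
  Submodule.iSup_induction' (motive := P) _ h h0 hadd hq

theorem mulOp_mem_evenPart (c : k) (x y : V) {q : F.SymAlg} (hq : q ∈ F.evenPart) :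
    F.mulOp c x y q ∈ F.evenPart := by
  induction hq using evenPart_induction with
  | h0 => rw [map_zero]; exact Submodule.zero_mem _
  | hadd p q _ _ hp hq => rw [map_add]; exact Submodule.add_mem _ hp hq
  | h r q hq =>
    rw [mulOp_apply c x y hq]
    refine Submodule.add_mem _ (mem_evenPart (r := r + 1) ?_)
      (Submodule.smul_mem _ _ (mem_evenPart (r := r - 1) ?_))
    · simpa only [mul_add, mul_one] using mul_mul_mem_deg hq x y
    · simpa only [mul_sub, mul_one] using der_der_mem_deg hq x y

theorem adOp_mem_evenPart (x y : V) {q : F.SymAlg} (hq : q ∈ F.evenPart) :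
    F.adOp x y q ∈ F.evenPart := by
  induction hq using evenPart_induction with
  | h0 => rw [map_zero]; exact Submodule.zero_mem _
  | hadd p q _ _ hp hq => rw [map_add]; exact Submodule.add_mem _ hp hq
  | h r q hq => exact mem_evenPart (adOp_mem_deg hq x y)

variable (F)

/-- The restriction of `mulOp` to the even part. -/
def mulEven (c : k) : V →ₗ[k] V →ₗ[k] Module.End k F.evenPart :=
  LinearMap.mk₂ k (fun x y => (F.mulOp c x y).restrict fun _ => mulOp_mem_evenPart c x y)
    (fun _ _ _ => by ext; simp) (fun _ _ _ => by ext; simp)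
    (fun _ _ _ => by ext; simp) (fun _ _ _ => by ext; simp)

/-- The restriction of `adOp` to the even part. -/
def adEven : V →ₗ[k] V →ₗ[k] Module.End k F.evenPart :=
  LinearMap.mk₂ k (fun x y => (F.adOp x y).restrict fun _ => adOp_mem_evenPart x y)
    (fun _ _ _ => by ext; simp) (fun _ _ _ => by ext; simp)
    (fun _ _ _ => by ext; simp) (fun _ _ _ => by ext; simp)

variable {F}

theorem coe_mulEven (c : k) (x y : V) (q : F.evenPart) :
    (F.mulEven c x y q : F.SymAlg) = F.mulOp c x y q := rfl

theorem coe_adEven (x y : V) (q : F.evenPart) :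
    (F.adEven x y q : F.SymAlg) = F.adOp x y q := rfl

/-- Operators on the even part which agree on every homogeneous component are equal. -/
theorem evenPart_hom_ext {A : Type*} [AddCommGroup A] [Module k A] {φ ψ : F.evenPart →ₗ[k] A}
    (h : ∀ r : ℕ, ∀ q : F.evenPart, (q : F.SymAlg) ∈ F.deg ((2 * r : ℤ) : k) → φ q = ψ q) :
    φ = ψ := by
  refine LinearMap.ext fun ⟨q, hq⟩ => ?_
  induction hq using evenPart_induction with
  | h0 => exact (φ.map_zero).trans (ψ.map_zero).symm
  | hadd p q hp hq hp' hq' =>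
    have := congrArg₂ (· + ·) hp' hq'
    exact (φ.map_add ⟨p, hp⟩ ⟨q, hq⟩).trans (this.trans (ψ.map_add ⟨p, hp⟩ ⟨q, hq⟩).symm)
  | h r q hq => exact h r _ hq

theorem sum_mulEven_e_f (c : k) : ∑ i, F.mulEven c (F.e i) (F.f i) = 0 := by
  refine LinearMap.ext fun q => Subtype.ext ?_
  simpa [coe_mulEven] using sum_mulOp_e_f c (q : F.SymAlg)

theorem sum_adEven_e_f : ∑ i, F.adEven (F.e i) (F.f i) = 0 := by
  refine LinearMap.ext fun q => Subtype.ext ?_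
  simpa [coe_adEven] using sum_adOp_e_f (q : F.SymAlg)

theorem sum_mulEven_mulEven (c : k) (x y : V) :
    ∑ i, F.mulEven c x (F.e i) * F.mulEven c (F.f i) y = (c / 2 * F.B x y) • 1 := by
  refine evenPart_hom_ext fun r q hq => Subtype.ext ?_
  simpa [coe_mulEven] using sum_mulOp_mulOp c x y hq

theorem sum_sum_mulEven_adEven (c : k) :
    ∑ j, ∑ i, F.mulEven c (F.e j) (F.e i) * F.adEven (F.f i) (F.f j) = 0 := by
  refine evenPart_hom_ext fun r q hq => Subtype.ext ?_
  simpa [coe_mulEven, coe_adEven] using sum_sum_mulOp_adOp c hq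

theorem adEven_mul_mulEven (c : k) (x y z w : V) :
    F.adEven x y * F.mulEven c z w = (2 * F.B y z) • F.mulEven c x w +
      F.B x y • F.mulEven c z w + F.B z w • F.mulEven c x y +
      (F.mulEven c x y * F.adEven z w +
      (2 * F.B y z) • ∑ i, F.mulEven c x (F.e i) * F.adEven (F.f i) w +
      F.B x y • ∑ i, F.mulEven c z (F.e i) * F.adEven (F.f i) w +
      F.B z w • ∑ i, F.mulEven c x (F.e i) * F.adEven (F.f i) y) := by
  refine evenPart_hom_ext fun r q hq => Subtype.ext ?_
  simpa [coe_mulEven, coe_adEven] using adOp_mulOp c x y z w hq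

/-- The degree zero element `1`, as an element of the even part. -/
def evenOne : F.evenPart := ⟨1, mem_evenPart (r := 0) (by simpa using one_mem_deg)⟩

theorem adEven_one (x y : V) : F.adEven x y evenOne = 0 := by
  refine Subtype.ext ?_
  rw [coe_adEven, evenOne, adOp_eq, der_one, euler_one, mul_zero, smul_zero, add_zero]
  rfl

/-- Up to a scalar, an element `q` of degree `m` is a combination of the results of the operators
`mulOp`, applied to elements of degree `m - 2`. -/
theorem sum_mulOp_der_der (c : k) {m : ℤ} {q : F.SymAlg} (hq : q ∈ F.deg (m : k)) :
    ∑ i, ∑ j, F.mulOp c (F.e i) (F.e j) (F.der (F.f j) (F.der (F.f i) q)) =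
      ((m : k) * (m - 1)) • q := by
  have h1 := fun i => sum_gen_mul_der_of_mem (der_mem_deg hq (F.f i))
  have h2 := sum_gen_mul_der_of_mem hq
  simp_rw [mulOp_apply c _ _ (der_der_mem_deg hq _ _), Finset.sum_add_distrib, ← Finset.smul_sum,
    ← Finset.mul_sum, h1, ← map_sum, F.sum_der_der, map_zero, Finset.sum_const_zero, smul_zero,
    add_zero, mul_smul_comm, ← Finset.smul_sum, h2, smul_smul, mul_comm]

section Inverse

variable {A : Type*} [Ring A] [Algebra k A] (P : V →ₗ[k] V →ₗ[k] A)

variable (F) in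
/-- The restriction to degree `2 r` of the map to the hyperboloid which is inverse to the action
on `1`; here `P x y` is the generator `x ⊗ y` of the hyperboloid. It is dictated by
`sum_mulOp_der_der` and `symbolInv_mulOp`, and is meaningful in degree `2 r` only. -/
def symbolInv : ℕ → F.SymAlg →ₗ[k] A
  | 0 => Algebra.linearMap k A ∘ₗ F.aug.toLinearMap
  | r + 1 => (((2 * r + 2 : ℕ) : k) * ((2 * r + 1 : ℕ) : k))⁻¹ • ∑ i, ∑ j,
      LinearMap.mulLeft k (P (F.e i) (F.e j)) ∘ₗ symbolInv r ∘ₗ F.der (F.f j) ∘ₗ F.der (F.f i)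

theorem symbolInv_succ (r : ℕ) (q : F.SymAlg) :
    ((((2 * r : ℤ) : k) + 2) * (((2 * r : ℤ) : k) + 1)) • F.symbolInv P (r + 1) q =
      ∑ i, ∑ j, P (F.e i) (F.e j) * F.symbolInv P r (F.der (F.f j) (F.der (F.f i) q)) := by
  have h1 : (((2 * r : ℤ) : k) + 2) * (((2 * r : ℤ) : k) + 1) =
      ((2 * r + 2 : ℕ) : k) * ((2 * r + 1 : ℕ) : k) := by push_cast; ring
  have h2 : ((2 * r + 2 : ℕ) : k) * ((2 * r + 1 : ℕ) : k) ≠ 0 :=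
    mul_ne_zero (Nat.cast_ne_zero.2 (Nat.succ_ne_zero _)) (Nat.cast_ne_zero.2 (Nat.succ_ne_zero _))
  rw [symbolInv, h1, LinearMap.smul_apply, smul_inv_smul₀ h2]
  simp

variable {P} {Ψ : F.SymAlg →ₗ[k] A} (hΨ : ∀ r : ℕ, ∀ q ∈ F.deg ((2 * r : ℤ) : k),
  Ψ q = F.symbolInv P r q) (hP1 : ∑ i, P (F.e i) (F.f i) = 0) {c : k}
  (hP2 : ∀ x y, ∑ i, P x (F.e i) * P (F.f i) y = algebraMap k A (c / 2 * F.B x y))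

include hP2 in
/-- The relation `hP2` applied to an element of odd degree, once the equivariance of `Ψ` is known in
the degree below. -/
theorem sum_mul_symbolInv_gen_mul {r : ℤ} (x : V) {t : F.SymAlg}
    (ht : t ∈ F.deg (((2 * r + 1 : ℤ) : k)))
    (ih : ∀ q ∈ F.deg ((2 * r : ℤ) : k), ∀ x y, Ψ (F.mulOp c x y q) = P x y * Ψ q) :
    ((2 * r + 1 : ℤ) : k) • ∑ j, P x (F.e j) * Ψ (F.gen (F.f j) * t) =
      (c / 2) • Ψ (F.der x t) := by
  have hd : ∀ y, F.der y t ∈ F.deg ((2 * r : ℤ) : k) := fun y => by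
    have := der_mem_deg ht y
    rwa [show ((2 * r + 1 : ℤ) : k) - 1 = ((2 * r : ℤ) : k) by push_cast; ring] at this
  -- `t` is expanded as a multiple of `∑ e i ∂_{f i} t`
  have h1 : ∀ j, ((2 * r + 1 : ℤ) : k) • Ψ (F.gen (F.f j) * t) =
      ∑ i, P (F.f j) (F.e i) * Ψ (F.der (F.f i) t) := by
    intro j
    rw [← map_smul, ← mul_smul_comm, ← sum_gen_mul_der_of_mem ht]
    have h2 : ∀ i, F.gen (F.f j) * (F.gen (F.e i) * F.der (F.f i) t) =
        F.mulOp c (F.f j) (F.e i) (F.der (F.f i) t) -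
          lowCoeff c ((2 * r : ℤ) : k) • F.der (F.f j) (F.der (F.e i) (F.der (F.f i) t)) :=
      fun i => by rw [mulOp_apply c _ _ (hd _), add_sub_cancel_right]
    simp_rw [Finset.mul_sum, h2, Finset.sum_sub_distrib, ← Finset.smul_sum, ← map_sum,
      F.sum_der_der, map_zero, smul_zero, sub_zero, map_sum, ih _ (hd _)]
  rw [Finset.smul_sum]
  simp_rw [← mul_smul_comm, h1, Finset.mul_sum]
  rw [Finset.sum_comm]
  simp_rw [← mul_assoc, ← Finset.sum_mul, hP2, ← Algebra.smul_def, mul_smul, ← Finset.smul_sum]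
  congr 1
  exact F.sum_right_map (Ψ ∘ₗ F.der.flip t) x

include hΨ hP1 hP2 in
/-- The induction step of `symbolInv_mulOp`: in the definition of `Ψ (x y q)` the second
derivatives of `x y q` are expanded (`hexp`), and of the four sums that arise, the first gives
`P x y * Ψ q`, the second the lowering part of `mulOp`, and the other two vanish. -/
theorem symbolInv_mulOp_step (r : ℕ)
    (ih : ∀ q ∈ F.deg ((2 * (r - 1) : ℤ) : k), ∀ x y, Ψ (F.mulOp c x y q) = P x y * Ψ q)
    (q : F.SymAlg) (hq : q ∈ F.deg ((2 * r : ℤ) : k)) (x y : V) :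
    Ψ (F.mulOp c x y q) = P x y * Ψ q := by
  have hlow := fun x t ht => sum_mul_symbolInv_gen_mul (t := t) hP2 (r := r - 1) x ht ih
  rw [show (2 * ((r : ℤ) - 1) + 1 : ℤ) = 2 * r - 1 by ring] at hlow
  have hL := lowCoeff_mul c (k := k) r
  have hm1 := two_mul_cast_add_ne_zero (k := k) r (-1)
  have hm2 := two_mul_cast_add_ne_zero (k := k) r 0
  have hcast : ((2 * r - 1 : ℤ) : k) = ((2 * r : ℤ) : k) - 1 := by push_cast; ring
  have hcast2 : ((2 * r + 2 : ℤ) : k) = ((2 * r : ℤ) : k) + 2 := by push_cast; ring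
  have hsucc := symbolInv_succ (F := F) P r (F.gen x * (F.gen y * q))
  have hm3 : (((2 * r : ℤ) : k) + 2) ≠ 0 := by
    rw [← hcast2]
    exact Int.cast_ne_zero.2 (by omega)
  have hxy := mul_mul_mem_deg hq x y
  rw [← hΨ (r + 1) _ (by push_cast at hxy ⊢; rwa [mul_add, mul_one])] at hsucc
  have hmem : ∀ i j, F.der (F.f j) (F.der (F.f i) (F.gen x * (F.gen y * q))) ∈
      F.deg ((2 * r : ℤ) : k) := fun i j => by
    simpa using der_der_mem_deg hxy (F.f j) (F.f i)
  simp_rw [← hΨ r _ (hmem _ _)] at hsucc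
  rw [mulOp_apply c x y hq, map_add, map_smul]
  generalize ((2 * r : ℤ) : k) = m at *
  have hm1' : m - 1 ≠ 0 := by
    intro h
    apply hm1
    rw [← h]
    push_cast
    ring
  have hm2' : m + 1 ≠ 0 := by simpa using hm2
  rw [hcast] at hlow
  have hyq := der_mem_deg hq y
  have hs : F.der x (F.gen y * q) ∈ F.deg m := by
    simpa using der_mem_deg (gen_mul_mem_deg hq y) x
  set s := F.der x (F.gen y * q) with hs_def
  have hexp : ∀ i j, F.der (F.f j) (F.der (F.f i) (F.gen x * (F.gen y * q))) =
      ((m + 2) * (m + 1)) • (F.B (F.f i) x • (F.B (F.f j) y • q)) +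
      (m + 2) • (F.B (F.f i) x • (F.gen (F.f j) * F.der y q)) +
      (m + 1) • (F.B (F.f j) (F.f i) • s) + F.gen (F.f j) * F.der (F.f i) s := by
    intro i j
    rw [der_gen_mul_of_mem (gen_mul_mem_deg hq y), map_add, map_smul, der_gen_mul_of_mem hq,
      der_gen_mul_of_mem hs]
    module
  have e1 : ∑ i, F.B (F.f i) x • ∑ j, F.B (F.f j) y • (P (F.e i) (F.e j) * Ψ q) =
      P x y * Ψ q := by
    have h1 := fun i => F.sum_left_map (LinearMap.mulRight k (Ψ q) ∘ₗ P (F.e i)) y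
    have h2 := F.sum_left_map (LinearMap.mulRight k (Ψ q) ∘ₗ P.flip y) x
    simp only [LinearMap.comp_apply, LinearMap.mulRight_apply, LinearMap.flip_apply] at h1 h2
    simp_rw [h1, h2]
  have e2 : ∑ i, F.B (F.f i) x • ∑ j, P (F.e i) (F.e j) * Ψ (F.gen (F.f j) * F.der y q) =
      ∑ j, P x (F.e j) * Ψ (F.gen (F.f j) * F.der y q) := by
    simp_rw [Finset.smul_sum]
    rw [Finset.sum_comm]
    refine Finset.sum_congr rfl fun j _ => ?_
    exact F.sum_left_map (LinearMap.mulRight k (Ψ (F.gen (F.f j) * F.der y q)) ∘ₗ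
      P.flip (F.e j)) x
  have e3 : ∑ i, ∑ j, F.B (F.f j) (F.f i) • (P (F.e i) (F.e j) * Ψ s) = 0 := by
    have h1 := fun i => F.sum_left_map (LinearMap.mulRight k (Ψ s) ∘ₗ P (F.e i)) (F.f i)
    simp only [LinearMap.comp_apply, LinearMap.mulRight_apply] at h1
    simp_rw [h1, ← Finset.sum_mul, hP1, zero_mul]
  have e4 : ∑ i, ∑ j, P (F.e i) (F.e j) * Ψ (F.gen (F.f j) * F.der (F.f i) s) = 0 := by
    have h1 := fun i => hlow (F.e i) _ (der_mem_deg hs (F.f i))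
    have : (m - 1) • ∑ i, ∑ j, P (F.e i) (F.e j) * Ψ (F.gen (F.f j) * F.der (F.f i) s) = 0 := by
      rw [Finset.smul_sum]
      simp_rw [h1, ← Finset.smul_sum, ← map_sum, F.sum_der_der, map_zero, smul_zero]
    exact (smul_eq_zero.1 this).resolve_left hm1'
  have e5 := hlow x _ hyq
  simp_rw [hexp, map_add, map_smul, mul_add, mul_smul_comm, Finset.sum_add_distrib,
    ← Finset.smul_sum, e1, e2, e3, e4, smul_zero, add_zero] at hsucc
  rw [show (m + 2) * m + (m + 2) * 1 = (m + 2) * (m + 1) by ring] at hsucc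
  have hne : (m - 1) * ((m + 2) * (m + 1)) ≠ 0 := mul_ne_zero hm1' (mul_ne_zero hm3 hm2')
  refine (smul_right_injective A hne) ?_
  have hL' : (m - 1) * ((m + 2) * (m + 1)) * lowCoeff c m = -((m + 2) * (c / 2)) := by
    calc _ = ((m + 2) * (m + 1)) * ((m - 1) * lowCoeff c m) := by ring
      _ = _ := by rw [hL]; field_simp
  simp only [smul_add, smul_smul, hL']
  rw [mul_smul, hsucc, smul_add, smul_comm (m - 1) (m + 2), e5]
  module

include hΨ hP1 hP2 in
/-- The map `Ψ` glued from the `symbolInv P r` intertwines the operators `mulOp` with the left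
multiplications by the generators. -/
theorem symbolInv_mulOp (r : ℕ) : ∀ q ∈ F.deg ((2 * r : ℤ) : k), ∀ x y,
    Ψ (F.mulOp c x y q) = P x y * Ψ q := by
  induction r with
  | zero =>
    refine symbolInv_mulOp_step hΨ hP1 hP2 0 fun q hq x y => ?_
    rw [F.deg_eq_bot_of_neg (by norm_num), Submodule.mem_bot] at hq
    rw [hq, map_zero, map_zero, mul_zero]
  | succ r ih =>
    refine symbolInv_mulOp_step hΨ hP1 hP2 (r + 1) ?_
    rwa [Nat.cast_succ, add_sub_cancel_right]

omit hΨ in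
include hP1 hP2 in
/-- An algebra with generators `P x y` subject to the relations of the hyperboloid, which acts on
the even part of the symmetric algebra by the operators `mulEven`, is identified with the even
part by its action on `1`. -/
theorem orbit_bijective
    (hgen : ∀ N : Submodule k A, 1 ∈ N → (∀ x y, ∀ a ∈ N, P x y * a ∈ N) → N = ⊤)
    (Θ : A →ₐ[k] Module.End k F.evenPart) (hΘ : ∀ x y, Θ (P x y) = F.mulEven c x y) :
    Function.Bijective (LinearMap.applyₗ evenOne ∘ₗ Θ.toLinearMap : A →ₗ[k] F.evenPart) := by
  set orbit : A →ₗ[k] F.evenPart := LinearMap.applyₗ evenOne ∘ₗ Θ.toLinearMap with horbit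
  have horb : ∀ x y a, orbit (P x y * a) = F.mulEven c x y (orbit a) := fun x y a => by
    simp [orbit, hΘ]
  have horb1 : orbit 1 = evenOne := by simp [orbit]
  constructor
  · obtain ⟨Ψ, hΨ'⟩ := exists_glue F fun m => F.symbolInv P (m / 2)
    have hΨ : ∀ r : ℕ, ∀ q ∈ F.deg ((2 * r : ℤ) : k), Ψ q = F.symbolInv P r q := fun r q hq => by
      have := hΨ' (2 * r) q (by push_cast at hq ⊢; exact hq)
      rwa [Nat.mul_div_cancel_left r two_pos] at this
    have hmul : ∀ q ∈ F.evenPart, ∀ x y, Ψ (F.mulOp c x y q) = P x y * Ψ q := by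
      intro q hq x y
      induction hq using evenPart_induction with
      | h0 => simp
      | hadd p q _ _ hp hq => simp only [map_add, hp, hq, mul_add]
      | h r q hq => exact symbolInv_mulOp hΨ hP1 hP2 r q hq x y
    have hinv : ∀ a, Ψ (orbit a) = a := by
      have := hgen (LinearMap.eqLocus (Ψ ∘ₗ F.evenPart.subtype ∘ₗ orbit) LinearMap.id) ?_ ?_
      · intro a
        exact this.ge (Submodule.mem_top (x := a))
      · change Ψ (orbit 1 : F.evenPart) = 1
        rw [horb1]
        have := hΨ 0 1 (by simpa using one_mem_deg)
        rw [evenOne, this, symbolInv]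
        simp
      · intro x y a ha
        change Ψ (orbit a : F.evenPart) = a at ha
        change Ψ (orbit (P x y * a) : F.evenPart) = P x y * a
        rw [horb, coe_mulEven, hmul _ (orbit a).2, ha]
    intro a b hab
    rw [← hinv a, hab, hinv b]
  · have hsub : ∀ r : ℕ, ∀ q ∈ F.deg ((2 * r : ℤ) : k), ∃ a, (orbit a : F.SymAlg) = q := by
      intro r
      induction r with
      | zero =>
        intro q hq
        rw [Nat.cast_zero, mul_zero, Int.cast_zero, deg_zero, Submodule.mem_span_singleton] at hq
        obtain ⟨b, rfl⟩ := hq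
        exact ⟨b • 1, by rw [map_smul, horb1]; rfl⟩
      | succ r ih =>
        intro q hq
        have h1 := sum_mulOp_der_der c hq
        have h2 : ∀ i j, F.der (F.f j) (F.der (F.f i) q) ∈ F.deg ((2 * r : ℤ) : k) := fun i j => by
          have := der_der_mem_deg hq (F.f j) (F.f i)
          rwa [show 2 * ((r + 1 : ℕ) : ℤ) - 2 = 2 * r by push_cast; ring] at this
        choose a ha using fun i j => ih _ (h2 i j)
        have h3 : (((2 * (r + 1 : ℕ) : ℤ) : k) * (((2 * (r + 1 : ℕ) : ℤ) : k) - 1)) ≠ 0 := by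
          have : (2 * (r + 1 : ℕ) : ℤ) * ((2 * (r + 1 : ℕ) : ℤ) - 1) ≠ 0 :=
            mul_ne_zero (by omega) (by omega)
          exact_mod_cast this
        refine ⟨(((2 * (r + 1 : ℕ) : ℤ) : k) * (((2 * (r + 1 : ℕ) : ℤ) : k) - 1))⁻¹ •
          ∑ i, ∑ j, P (F.e i) (F.e j) * a i j, ?_⟩
        simp only [map_smul, map_sum, horb, Submodule.coe_smul, Submodule.coe_sum, coe_mulEven,
          ha, h1]
        rw [inv_smul_smul₀ h3]
    rw [← LinearMap.range_eq_top, eq_top_iff]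
    have : F.evenPart ≤ (LinearMap.range orbit).map F.evenPart.subtype := by
      refine iSup_le fun r q hq => ?_
      obtain ⟨a, ha⟩ := hsub r q hq
      exact ⟨orbit a, ⟨a, rfl⟩, ha⟩
    rintro ⟨q, hq⟩ _
    obtain ⟨q', hq', h⟩ := this hq
    rwa [← Subtype.ext (a1 := q') (a2 := ⟨q, hq⟩) h]

end Inverse

end RankTwoForm

/-! ### The twisted Lie algebra in terms of the form -/

namespace RankTwoForm

variable {k V ι : Type*} [Field k] [AddCommGroup V] [Module k V]
  [Fintype ι] (F : RankTwoForm k V ι)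

/-- The operator `z ↦ B y z • x`, that is, `x ⊗ y` under the identification of `V` with `V*`
given by `y ↦ B y`. -/
def op : V →ₗ[k] V →ₗ[k] Module.End k V :=
  LinearMap.mk₂ k (fun x y => (F.B y).smulRight x)
    (fun _ _ _ => by ext; simp) (fun a _ _ => by ext; simp [smul_comm a])
    (fun _ _ _ => by ext; simp [add_smul]) (fun _ _ _ => by ext; simp [smul_smul])

theorem op_apply (x y z : V) : F.op x y z = F.B y z • x := rfl

theorem op_mul_op (x y z w : V) : F.op x y * F.op z w = F.B y z • F.op x w := by
  ext a
  simp [op_apply, smul_smul, mul_comm]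

theorem sum_op_e_f : ∑ i, F.op (F.e i) (F.f i) = 1 := by
  ext a
  simp [op_apply, F.sum_left]

section

variable {F}

theorem sum_B_mul_B_right (x y : V) :
    ∑ i, F.B x (F.e i) * F.B y (F.f i) = F.B y x := by
  simpa using F.sum_right_map (F.B y) x

theorem sum_B_mul_B_left (x y : V) :
    ∑ i, F.B (F.f i) x * F.B (F.e i) y = F.B x y := by
  simpa using F.sum_left_map (F.B.flip y) x

end

variable [FiniteDimensional k V]

theorem endEquiv_tmul (x : V) (φ : Module.Dual k V) :
    Symmetry.endEquiv k V (x ⊗ₜ φ) = φ.smulRight x := by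
  ext a
  simp [Symmetry.endEquiv]

theorem endEquiv_symm_op (x y : V) : (Symmetry.endEquiv k V).symm (F.op x y) = x ⊗ₜ F.B y := by
  rw [LinearEquiv.symm_apply_eq, endEquiv_tmul]
  rfl

variable {F} {S : Symmetry k V}
  (hS : ∀ x y, S.op (x ⊗ₜ y) = x ⊗ₜ y + F.B x y • ∑ i, F.e i ⊗ₜ[k] F.f i)

include hS

omit [FiniteDimensional k V] in
theorem columnMap_B (y z : V) :
    columnMap S.op (F.B y ⊗ₜ z) = F.B y z • 1 + F.op y z := by
  ext a
  have := F.sum_right a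
  have h2 := F.sum_right y
  simp [columnMap, hS, op_apply, h2]

/-- In terms of `V ≃ V*`, `y ↦ B y`, all four twists are given by the formula for `S`. -/
theorem dualLeft_B (y z : V) : S.dualLeft (F.B y ⊗ₜ z) =
    y ⊗ₜ F.B z + F.B y z • ∑ i, F.e i ⊗ₜ[k] F.B (F.f i) := by
  change (Symmetry.endEquiv k V).symm (columnMap S.op (F.B y ⊗ₜ z)) = _
  rw [columnMap_B hS, ← F.sum_op_e_f]
  simp [endEquiv_symm_op, add_comm]

theorem dualRight_B (x y : V) : S.dualRight (x ⊗ₜ F.B y) =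
    F.B x ⊗ₜ y + F.B x y • ∑ i, F.B (F.e i) ⊗ₜ[k] F.f i := by
  change S.dualLeft.symm _ = _
  rw [LinearEquiv.symm_apply_eq]
  simp only [map_add, map_smul, map_sum, dualLeft_B hS, Finset.sum_add_distrib, ← Finset.sum_smul,
    F.trace]
  module

omit hS in
theorem dualDistribEquiv_comm_apply (φ ψ : Module.Dual k V) (x y : V) :
    TensorProduct.dualDistribEquiv k V V (TensorProduct.comm k _ _ (φ ⊗ₜ ψ)) (x ⊗ₜ y) =
      ψ x * φ y := rfl

theorem dualDual_B (z w : V) : S.dualDual (F.B z ⊗ₜ F.B w) =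
    F.B z ⊗ₜ F.B w + F.B z w • ∑ i, F.B (F.e i) ⊗ₜ[k] F.B (F.f i) := by
  rw [Symmetry.dualDual]
  simp only [LinearMap.comp_apply, LinearEquiv.coe_coe]
  apply (TensorProduct.comm k (Module.Dual k V) (Module.Dual k V)).injective
  apply (TensorProduct.dualDistribEquiv k V V).injective
  rw [show ∀ t, TensorProduct.comm k (Module.Dual k V) (Module.Dual k V)
    (TensorProduct.comm k (Module.Dual k V) (Module.Dual k V) t) = t from
      (TensorProduct.comm k _ _).symm_apply_apply, LinearEquiv.apply_symm_apply]
  refine TensorProduct.ext' fun x y => ?_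
  have h1 := sum_B_mul_B_right (F := F) w z
  have h2 := sum_B_mul_B_left (F := F) x y
  simp only [LinearMap.dualMap_apply, hS, map_add, map_smul, map_sum, LinearMap.add_apply,
    LinearMap.smul_apply, LinearMap.sum_apply, dualDistribEquiv_comm_apply, h1, smul_eq_mul]
  have h3 : ∑ i, F.B (F.f i) x * F.B (F.e i) y = F.B x y := h2
  rw [h3]
  ring

theorem str_op (x y : V) : S.str (F.op x y) = -F.B x y := by
  simp only [Symmetry.str, LinearMap.comp_apply, LinearEquiv.coe_coe, endEquiv_symm_op,
    dualRight_B hS, map_add, map_smul, map_sum, contractLeft_apply, F.trace, smul_eq_mul]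
  ring

theorem str_one : S.str 1 = 2 := by
  rw [← F.sum_op_e_f, map_sum]
  simp_rw [str_op hS]
  rw [Finset.sum_neg_distrib, F.trace, neg_neg]

variable (F) in
omit hS in
/-- `a ⊗ b ⊗ c ⊗ d ↦ a ⊗ S (b ⊗ c) ⊗ d`, as an element of `End V ⊗ End V`. -/
def midTwist (a b c d : V) : Module.End k V ⊗[k] Module.End k V :=
  F.op a b ⊗ₜ F.op c d + F.B b c • ∑ i, F.op a (F.e i) ⊗ₜ[k] F.op (F.f i) d

variable (F) in
omit hS in
/-- `a ⊗ b ⊗ c ⊗ d ↦ S (a ⊗ b) ⊗ S (c ⊗ d)`, followed by `S` on the two inner factors, as an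
element of `End V ⊗ End V`. -/
def outerTwist (a b c d : V) : Module.End k V ⊗[k] Module.End k V :=
  F.midTwist a b c d + F.B a b • ∑ i, F.midTwist (F.e i) (F.f i) c d +
    F.B c d • ∑ i, F.midTwist a b (F.e i) (F.f i) +
    (F.B a b * F.B c d) • ∑ i, ∑ j, F.midTwist (F.e i) (F.f i) (F.e j) (F.f j)

theorem endTwist_op (x y z w : V) : S.endTwist (F.op x y ⊗ₜ F.op z w) =
    F.outerTwist x y z w + F.B y z • ∑ i, F.outerTwist x (F.e i) (F.f i) w := by
  have h1 : ∀ a b c d, TensorProduct.congr (Symmetry.endEquiv k V) (Symmetry.endEquiv k V)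
      ((TensorProduct.tensorTensorTensorAssoc k V _ V _).symm
        ((S.dualRight.lTensor V).rTensor (Module.Dual k V)
          (TensorProduct.tensorTensorTensorAssoc k V V _ _
            ((a ⊗ₜ b) ⊗ₜ (F.B c ⊗ₜ F.B d))))) = F.midTwist a b c d := by
    intro a b c d
    simp [dualRight_B hS, midTwist, TensorProduct.tmul_add, TensorProduct.add_tmul,
      TensorProduct.tmul_sum, TensorProduct.sum_tmul, endEquiv_tmul, ← TensorProduct.smul_tmul',
      op]
  have h2 : ∀ a b c d, TensorProduct.congr (Symmetry.endEquiv k V) (Symmetry.endEquiv k V)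
      ((TensorProduct.tensorTensorTensorAssoc k V _ V _).symm
        ((S.dualRight.lTensor V).rTensor (Module.Dual k V)
          (TensorProduct.tensorTensorTensorAssoc k V V _ _
            (TensorProduct.map S.op S.dualDual ((a ⊗ₜ b) ⊗ₜ (F.B c ⊗ₜ F.B d)))))) =
      F.outerTwist a b c d := by
    intro a b c d
    rw [TensorProduct.map_tmul, hS, dualDual_B hS]
    simp only [TensorProduct.tmul_add, TensorProduct.add_tmul, TensorProduct.tmul_smul,
      TensorProduct.tmul_sum, TensorProduct.sum_tmul, ← TensorProduct.smul_tmul', map_add,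
      map_smul, map_sum, h1, outerTwist, Finset.smul_sum]
    simp only [smul_add, Finset.sum_add_distrib, Finset.smul_sum, smul_smul,
      mul_comm (F.B c d), add_assoc]
    congr 3
    exact Finset.sum_comm
  change TensorProduct.congr (Symmetry.endEquiv k V) (Symmetry.endEquiv k V)
    ((TensorProduct.tensorTensorTensorAssoc k V _ V _).symm
      ((S.dualRight.lTensor V).rTensor (Module.Dual k V)
        (TensorProduct.tensorTensorTensorAssoc k V V _ _
          (TensorProduct.map S.op S.dualDual
            ((TensorProduct.tensorTensorTensorAssoc k V V _ _).symm
              ((S.dualLeft.toLinearMap.lTensor V).rTensor (Module.Dual k V)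
                (TensorProduct.tensorTensorTensorAssoc k V _ V _
                  (((Symmetry.endEquiv k V).symm (F.op x y)) ⊗ₜ
                    ((Symmetry.endEquiv k V).symm (F.op z w)))))))))) = _
  simp only [endEquiv_symm_op, TensorProduct.tensorTensorTensorAssoc_tmul,
    LinearMap.rTensor_tmul, LinearMap.lTensor_tmul, LinearEquiv.coe_coe, dualLeft_B hS,
    TensorProduct.tmul_add, TensorProduct.add_tmul, TensorProduct.tmul_smul,
    TensorProduct.tmul_sum, TensorProduct.sum_tmul, ← TensorProduct.smul_tmul', map_add,
    map_smul, map_sum, TensorProduct.tensorTensorTensorAssoc_symm_tmul, h2]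

section Sl

variable [CharZero k]

theorem coe_slProj (X : Module.End k V) :
    (S.slProj X : Module.End k V) = X - ((2 : k)⁻¹ * S.str X) • 1 := by
  simp only [Symmetry.slProj, LinearMap.codRestrict_apply, LinearMap.smul_apply,
    LinearMap.sub_apply, LinearMap.id_apply, LinearMap.smulRight_apply, str_one hS, smul_sub,
    smul_smul]
  rw [inv_mul_cancel₀ two_ne_zero, one_smul]

theorem slProj_one : S.slProj 1 = 0 := by
  refine Subtype.ext ?_
  rw [coe_slProj hS, str_one hS, inv_mul_cancel₀ two_ne_zero, one_smul, sub_self]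
  rfl

theorem slProj_coe (X : S.sl) : S.slProj (X : Module.End k V) = X := by
  refine Subtype.ext ?_
  rw [coe_slProj hS, LinearMap.mem_ker.1 X.2, mul_zero, zero_smul, sub_zero]

omit hS [CharZero k] in
variable (F S) in
/-- The projection of the operator `x ⊗ y` to `sl(V_S)`. -/
def slOp : V →ₗ[k] V →ₗ[k] S.sl := F.op.compr₂ S.slProj

omit hS [CharZero k] in
theorem slOp_apply (x y : V) : F.slOp S x y = S.slProj (F.op x y) := rfl

theorem coe_slOp (x y : V) :
    (F.slOp S x y : Module.End k V) = F.op x y + ((2 : k)⁻¹ * F.B x y) • 1 := by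
  rw [slOp_apply, coe_slProj hS, str_op hS, mul_neg, neg_smul, sub_neg_eq_add]

theorem sum_slOp_e_f : ∑ i, F.slOp S (F.e i) (F.f i) = 0 := by
  simp_rw [slOp_apply, ← map_sum, F.sum_op_e_f, slProj_one hS]

theorem sum_slOp (X : S.sl) : ∑ i, F.slOp S ((X : Module.End k V) (F.e i)) (F.f i) = X := by
  simp_rw [slOp_apply, ← map_sum]
  have : ∑ i, F.op ((X : Module.End k V) (F.e i)) (F.f i) = X := by
    ext a
    simp only [LinearMap.sum_apply, op_apply, ← map_smul, ← map_sum, F.sum_left]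
  rw [this, slProj_coe hS]

omit hS [CharZero k] in
variable (F S) in
/-- The insertion of `∑ e i ⊗ f i` in the middle of `x ⊗ y`. -/
def nest : V →ₗ[k] V →ₗ[k] S.sl ⊗[k] S.sl :=
  ∑ i, (TensorProduct.mk k S.sl S.sl).compl₁₂ ((F.slOp S).flip (F.e i)) (F.slOp S (F.f i))

omit hS [CharZero k] in
theorem nest_apply (x y : V) :
    F.nest S x y = ∑ i, F.slOp S x (F.e i) ⊗ₜ[k] F.slOp S (F.f i) y := by
  simp [nest, LinearMap.sum_apply]

omit hS [CharZero k] in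
variable (F S) in
/-- The insertion of `∑ e i ⊗ f i` in the middle of itself. -/
def nestNest : S.sl ⊗[k] S.sl := ∑ j, F.nest S (F.e j) (F.f j)

omit hS [CharZero k] in
theorem nestNest_eq : F.nestNest S = ∑ j, F.nest S (F.e j) (F.f j) := rfl

omit hS [CharZero k] in
theorem sum_nest_left (x y : V) : ∑ i, F.B (F.f i) x • F.nest S (F.e i) y = F.nest S x y :=
  F.sum_left_map ((F.nest S).flip y) x

omit hS [CharZero k] in
theorem map_slProj_midTwist (a b c d : V) :
    TensorProduct.map S.slProj S.slProj (F.midTwist a b c d) =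
      F.slOp S a b ⊗ₜ F.slOp S c d + F.B b c • F.nest S a d := by
  simp [midTwist, nest_apply, slOp_apply]

theorem map_slProj_outerTwist (a b c d : V) :
    TensorProduct.map S.slProj S.slProj (F.outerTwist a b c d) =
      F.slOp S a b ⊗ₜ F.slOp S c d + F.B b c • F.nest S a d + F.B a b • F.nest S c d +
        F.B c d • F.nest S a b + (F.B a b * F.B c d) • F.nestNest S := by
  have h1 : ∀ c d, ∑ i, TensorProduct.map S.slProj S.slProj (F.midTwist (F.e i) (F.f i) c d) =
      F.nest S c d := fun c d => by
    simp_rw [map_slProj_midTwist, Finset.sum_add_distrib, ← TensorProduct.sum_tmul,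
      sum_slOp_e_f hS, TensorProduct.zero_tmul, zero_add, sum_nest_left]
  have h2 : ∑ i, TensorProduct.map S.slProj S.slProj (F.midTwist a b (F.e i) (F.f i)) =
      F.nest S a b := by
    simp_rw [map_slProj_midTwist, Finset.sum_add_distrib, ← TensorProduct.tmul_sum,
      sum_slOp_e_f hS, TensorProduct.tmul_zero, zero_add]
    exact F.sum_right_map (F.nest S a) b
  have h3 : ∑ i, ∑ j, TensorProduct.map S.slProj S.slProj
      (F.midTwist (F.e i) (F.f i) (F.e j) (F.f j)) = F.nestNest S := by
    rw [Finset.sum_comm]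
    simp_rw [h1]
    rfl
  simp only [outerTwist, map_add, map_smul, map_sum, h1, h2, h3]
  rw [map_slProj_midTwist]

theorem sum_map_slProj_outerTwist (x w : V) :
    ∑ i, TensorProduct.map S.slProj S.slProj (F.outerTwist x (F.e i) (F.f i) w) =
      F.nest S x w + F.B x w • F.nestNest S := by
  have h1 : ∑ i, F.B x (F.e i) • F.nest S (F.f i) w = F.nest S x w :=
    F.sum_right_map ((F.nest S).flip w) x
  have h2 : ∑ i, F.B (F.f i) w • F.nest S x (F.e i) = F.nest S x w :=
    F.sum_left_map (F.nest S x) w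
  have h3 : ∑ i, F.B x (F.e i) * F.B (F.f i) w = F.B x w := by
    simpa using F.sum_right_map (F.B.flip w) x
  simp_rw [map_slProj_outerTwist hS, Finset.sum_add_distrib, ← Finset.sum_smul, h1, h2, h3,
    ← nest_apply, F.trace]
  module

theorem map_slProj_endTwist (x y z w : V) :
    TensorProduct.map S.slProj S.slProj (S.endTwist (F.op x y ⊗ₜ F.op z w)) =
      F.slOp S x y ⊗ₜ F.slOp S z w + (2 * F.B y z) • F.nest S x w + F.B x y • F.nest S z w +
        F.B z w • F.nest S x y + (F.B x y * F.B z w + F.B y z * F.B x w) • F.nestNest S := by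
  rw [endTwist_op hS, map_add, map_smul, map_sum, sum_map_slProj_outerTwist hS,
    map_slProj_outerTwist hS]
  module

theorem map_slProj_endTwist_one_left (z w : V) :
    TensorProduct.map S.slProj S.slProj (S.endTwist (1 ⊗ₜ F.op z w)) = 0 := by
  have h1 := sum_nest_left (F := F) (S := S) z w
  have h2 : ∑ i, F.B (F.f i) z * F.B (F.e i) w = F.B z w := sum_B_mul_B_left z w
  rw [← F.sum_op_e_f, TensorProduct.sum_tmul, map_sum, map_sum]
  simp_rw [map_slProj_endTwist hS, Finset.sum_add_distrib, ← TensorProduct.sum_tmul,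
    sum_slOp_e_f hS, TensorProduct.zero_tmul, mul_smul, ← Finset.smul_sum, h1, ← Finset.sum_smul,
    Finset.sum_add_distrib, ← Finset.sum_mul, h2, F.trace, ← nestNest_eq]
  module

theorem map_slProj_endTwist_one_right (x y : V) :
    TensorProduct.map S.slProj S.slProj (S.endTwist (F.op x y ⊗ₜ 1)) = 0 := by
  have h1 : ∑ i, F.B y (F.e i) • F.nest S x (F.f i) = F.nest S x y := F.sum_right_map (F.nest S x) y
  have h2 : ∑ i, F.B y (F.e i) * F.B x (F.f i) = F.B x y := sum_B_mul_B_right y x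
  rw [← F.sum_op_e_f, TensorProduct.tmul_sum, map_sum, map_sum]
  simp_rw [map_slProj_endTwist hS, Finset.sum_add_distrib, ← TensorProduct.tmul_sum,
    sum_slOp_e_f hS, TensorProduct.tmul_zero, mul_smul, ← Finset.smul_sum, h1, ← Finset.sum_smul,
    Finset.sum_add_distrib, ← Finset.mul_sum, h2, F.trace, ← nestNest_eq]
  module

theorem map_slProj_endTwist_one_one :
    TensorProduct.map S.slProj S.slProj (S.endTwist (1 ⊗ₜ 1)) = 0 := by
  rw [← F.sum_op_e_f, TensorProduct.tmul_sum, map_sum, map_sum, F.sum_op_e_f]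
  simp_rw [map_slProj_endTwist_one_left hS, Finset.sum_const_zero]

/-- The twist of `sl(V_S)` on the generators `slOp`. -/
theorem slTwist_slOp (x y z w : V) : S.slTwist (F.slOp S x y ⊗ₜ F.slOp S z w) =
    F.slOp S x y ⊗ₜ F.slOp S z w + (2 * F.B y z) • F.nest S x w + F.B x y • F.nest S z w +
      F.B z w • F.nest S x y + (F.B x y * F.B z w + F.B y z * F.B x w) • F.nestNest S := by
  rw [Symmetry.slTwist, LinearMap.comp_apply, LinearMap.comp_apply, TensorProduct.map_tmul,
    Submodule.subtype_apply, Submodule.subtype_apply, coe_slOp hS, coe_slOp hS,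
    ← map_slProj_endTwist hS]
  simp only [TensorProduct.add_tmul, TensorProduct.tmul_add, TensorProduct.tmul_smul,
    ← TensorProduct.smul_tmul', map_add, map_smul, map_slProj_endTwist_one_left hS,
    map_slProj_endTwist_one_right hS, map_slProj_endTwist_one_one hS, smul_zero, add_zero]

omit hS [CharZero k] in
theorem slProj_mul_midTwist (a b c d : V) :
    S.slProj (LinearMap.mul' k _ (F.midTwist a b c d)) = -(F.B b c • F.slOp S a d) := by
  simp only [midTwist, map_add, map_smul, map_sum, LinearMap.mul'_apply, op_mul_op,
    ← Finset.sum_smul, F.trace, ← slOp_apply]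
  module

theorem slProj_mul_outerTwist (a b c d : V) :
    S.slProj (LinearMap.mul' k _ (F.outerTwist a b c d)) =
      -(F.B b c • F.slOp S a d + F.B a b • F.slOp S c d + F.B c d • F.slOp S a b) := by
  have h1 : ∀ c, ∑ i, F.B (F.f i) c • F.slOp S (F.e i) d = F.slOp S c d :=
    fun c => F.sum_left_map ((F.slOp S).flip d) c
  have h2 : ∑ i, F.B b (F.e i) • F.slOp S a (F.f i) = F.slOp S a b :=
    F.sum_right_map (F.slOp S a) b
  have h3 : ∑ i, ∑ j, F.B (F.f i) (F.e j) • F.slOp S (F.e i) (F.f j) = 0 := by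
    rw [Finset.sum_comm]
    have h4 : ∀ c d, ∑ i, F.B (F.f i) c • F.slOp S (F.e i) d = F.slOp S c d :=
      fun c d => F.sum_left_map ((F.slOp S).flip d) c
    simp_rw [h4, sum_slOp_e_f hS]
  simp only [outerTwist, map_add, map_smul, map_sum, slProj_mul_midTwist,
    Finset.sum_neg_distrib, h1, h2, h3]
  module

/-- The bracket of `sl(V_S)` on the generators `slOp`, before the correction by multiples of the
identity. -/
theorem slProj_glBracket (x y z w : V) : S.slProj (S.glBracket (F.op x y ⊗ₜ F.op z w)) =
    (2 * F.B y z) • F.slOp S x w + F.B x y • F.slOp S z w + F.B z w • F.slOp S x y := by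
  have h1 : ∑ i, F.B x (F.e i) • F.slOp S (F.f i) w = F.slOp S x w :=
    F.sum_right_map ((F.slOp S).flip w) x
  have h2 : ∑ i, F.B (F.f i) w • F.slOp S x (F.e i) = F.slOp S x w :=
    F.sum_left_map (F.slOp S x) w
  rw [Symmetry.glBracket, LinearMap.comp_apply, LinearMap.sub_apply, endTwist_op hS]
  simp only [LinearMap.id_apply, map_sub, map_add, map_smul, map_sum, LinearMap.mul'_apply,
    op_mul_op, slProj_mul_outerTwist hS, Finset.sum_neg_distrib, Finset.sum_add_distrib, h1, h2,
    ← Finset.sum_smul, F.trace, ← slOp_apply]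
  module

theorem slBracket_slOp (x y z w : V) : S.slBracket (F.slOp S x y ⊗ₜ F.slOp S z w) =
    (2 * F.B y z) • F.slOp S x w + F.B x y • F.slOp S z w + F.B z w • F.slOp S x y := by
  have hl : ∀ z w, S.slProj (S.glBracket (1 ⊗ₜ F.op z w)) = 0 := fun z w => by
    have h1 : ∑ i, F.B (F.f i) z • F.slOp S (F.e i) w = F.slOp S z w :=
      F.sum_left_map ((F.slOp S).flip w) z
    rw [← F.sum_op_e_f, TensorProduct.sum_tmul, map_sum, map_sum]
    simp_rw [slProj_glBracket hS, Finset.sum_add_distrib, mul_smul, ← Finset.smul_sum,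
      ← Finset.sum_smul, F.trace, h1, sum_slOp_e_f hS]
    module
  have hr : S.slProj (S.glBracket (F.op x y ⊗ₜ 1)) = 0 := by
    have h1 : ∑ i, F.B y (F.e i) • F.slOp S x (F.f i) = F.slOp S x y :=
      F.sum_right_map (F.slOp S x) y
    rw [← F.sum_op_e_f, TensorProduct.tmul_sum, map_sum, map_sum]
    simp_rw [slProj_glBracket hS, Finset.sum_add_distrib, mul_smul, ← Finset.smul_sum,
      ← Finset.sum_smul, F.trace, h1, sum_slOp_e_f hS]
    module
  have h11 : S.slProj (S.glBracket (1 ⊗ₜ 1)) = 0 := by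
    rw [← F.sum_op_e_f, TensorProduct.tmul_sum, map_sum, map_sum, F.sum_op_e_f]
    simp_rw [hl, Finset.sum_const_zero]
  rw [Symmetry.slBracket, LinearMap.comp_apply, LinearMap.comp_apply, TensorProduct.map_tmul,
    Submodule.subtype_apply, Submodule.subtype_apply, coe_slOp hS, coe_slOp hS,
    ← slProj_glBracket hS]
  simp only [TensorProduct.add_tmul, TensorProduct.tmul_add, TensorProduct.tmul_smul,
    ← TensorProduct.smul_tmul', map_add, map_smul, hl, hr, h11, smul_zero, add_zero]

end Sl

end RankTwoForm

/-! ### Maps out of tensor squares of `sl(V_S)`, and central determinants -/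

namespace RankTwoForm

section OfBilin

variable {k V ι : Type*} [Field k] [CharZero k] [AddCommGroup V] [Module k V]
  [FiniteDimensional k V] [Fintype ι] {F : RankTwoForm k V ι} {S : Symmetry k V}
  (hS : ∀ x y, S.op (x ⊗ₜ y) = x ⊗ₜ y + F.B x y • ∑ i, F.e i ⊗ₜ[k] F.f i)
  {N : Type*} [AddCommMonoid N] [Module k N]

variable (F S) in
/-- The linear map on `sl(V_S)` with value `G x y` on `slOp x y`, for a bilinear `G` that
vanishes on `∑ e i ⊗ f i`. It uses that `X` is the sum of the operators `X (e i) ⊗ f i`. -/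
def ofBilin (G : V →ₗ[k] V →ₗ[k] N) : S.sl →ₗ[k] N :=
  (∑ i, G.flip (F.f i) ∘ₗ LinearMap.applyₗ (F.e i)) ∘ₗ S.sl.subtype

omit [CharZero k] in
theorem ofBilin_apply (G : V →ₗ[k] V →ₗ[k] N) (X : S.sl) :
    F.ofBilin S G X = ∑ i, G ((X : Module.End k V) (F.e i)) (F.f i) := by
  simp [ofBilin]

include hS

theorem ofBilin_slOp {G : V →ₗ[k] V →ₗ[k] N} (hG : ∑ i, G (F.e i) (F.f i) = 0) (x y : V) :
    F.ofBilin S G (F.slOp S x y) = G x y := by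
  rw [ofBilin_apply, coe_slOp hS]
  simp only [LinearMap.add_apply, LinearMap.smul_apply, Module.End.one_apply, op_apply, map_add,
    map_smul, Finset.sum_add_distrib, ← Finset.smul_sum, hG, smul_zero, add_zero]
  exact F.sum_right_map (G x) y

/-- Linear maps on `sl ⊗ sl` are determined by their values on the generators `slOp`. -/
theorem slTensor_hom_ext {φ ψ : S.sl ⊗[k] S.sl →ₗ[k] N}
    (h : ∀ x y z w, φ (F.slOp S x y ⊗ₜ F.slOp S z w) = ψ (F.slOp S x y ⊗ₜ F.slOp S z w)) :
    φ = ψ := by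
  refine TensorProduct.ext' fun X Y => ?_
  rw [← sum_slOp hS X, ← sum_slOp hS Y]
  simp only [TensorProduct.sum_tmul, TensorProduct.tmul_sum, map_sum, h]

theorem slTwist_nest (x w : V) : S.slTwist (F.nest S x w) =
    (-1 : k) • F.nest S x w + (-F.B x w) • F.nestNest S := by
  have h1 : ∑ i, F.B x (F.e i) • F.nest S (F.f i) w = F.nest S x w :=
    F.sum_right_map ((F.nest S).flip w) x
  have h2 : ∑ i, F.B (F.f i) w • F.nest S x (F.e i) = F.nest S x w :=
    F.sum_left_map (F.nest S x) w
  have h3 : ∑ i, F.B x (F.e i) * F.B (F.f i) w = F.B x w := by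
    simpa using F.sum_right_map (F.B.flip w) x
  rw [nest_apply, map_sum]
  simp_rw [slTwist_slOp hS, Finset.sum_add_distrib, ← Finset.sum_smul, ← Finset.mul_sum,
    Finset.sum_add_distrib, ← Finset.sum_mul, h1, h2, h3, ← nest_apply, F.trace]
  module

omit [CharZero k] hS in
theorem mul_map_nest {R : Type*} [Ring R] [Algebra k R] (φ ψ : S.sl →ₗ[k] R) (x y : V) :
    LinearMap.mul' k R (TensorProduct.map φ ψ (F.nest S x y)) =
      ∑ i, φ (F.slOp S x (F.e i)) * ψ (F.slOp S (F.f i) y) := by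
  simp [nest_apply]

omit [CharZero k] hS in
theorem mul_map_nestNest {R : Type*} [Ring R] [Algebra k R] (φ ψ : S.sl →ₗ[k] R) :
    LinearMap.mul' k R (TensorProduct.map φ ψ (F.nestNest S)) =
      ∑ j, ∑ i, φ (F.slOp S (F.e j) (F.e i)) * ψ (F.slOp S (F.f i) (F.f j)) := by
  simp [nestNest_eq, mul_map_nest]

end OfBilin

section Frame

variable {k V : Type*} [Field k] [CharZero k] [AddCommGroup V] [Module k V] {n : ℕ}

/-- The bilinear form and the dual families attached to a symmetry of rank 2 with central
determinant, in a given basis. -/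
theorem _root_.TwistedHyperboloid.Symmetry.HasCentralDet.exists_form {S : Symmetry k V}
    (h : S.HasCentralDet) (x : Module.Basis (Fin n) k V) :
    ∃ F : RankTwoForm k V (Fin n), F.e = x ∧
      ∀ a b, S.op (a ⊗ₜ b) = a ⊗ₜ b + F.B a b • ∑ i, F.e i ⊗ₜ[k] F.f i := by
  obtain ⟨u, v, ⟨huv, huv1⟩, hM, hN⟩ := h
  have hz : ∀ v : V ⊗[k] V, ∃ z : Fin n → V, v = ∑ i, x i ⊗ₜ[k] z i := fun v => by
    induction v using TensorProduct.induction_on with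
    | zero => exact ⟨0, by simp⟩
    | tmul a b =>
      refine ⟨fun i => x.repr a i • b, ?_⟩
      simp_rw [← TensorProduct.smul_tmul, ← TensorProduct.sum_tmul, x.sum_repr]
    | add s t hs ht =>
      obtain ⟨z, rfl⟩ := hs
      obtain ⟨z', rfl⟩ := ht
      exact ⟨z + z', by simp [TensorProduct.tmul_add, Finset.sum_add_distrib]⟩
  obtain ⟨z, rfl⟩ := hz v
  refine ⟨⟨TensorProduct.curry u, x, fun i => (-2 : k) • z i, fun a => ?_, fun a => ?_, ?_⟩, rfl,
    fun a b => ?_⟩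
  · have := hM a
    simp only [map_sum, LinearMap.lTensor_tmul, LinearMap.comp_apply, LinearMap.flip_apply,
      TensorProduct.mk_apply, TensorProduct.rid_tmul] at this
    simpa [Finset.smul_sum, smul_smul] using this
  · have := hN a
    simp only [map_sum, LinearMap.rTensor_tmul, LinearMap.comp_apply,
      TensorProduct.mk_apply, TensorProduct.lid_tmul] at this
    simpa [Finset.smul_sum, smul_comm (-2 : k)] using this
  · rw [map_sum] at huv1
    simp only [TensorProduct.curry_apply, map_smul, smul_eq_mul,
      ← Finset.mul_sum, huv1, mul_one]
  · have := huv (a ⊗ₜ b)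
    rw [inv_smul_eq_iff₀ two_ne_zero] at this
    simp only [TensorProduct.curry_apply, TensorProduct.tmul_smul, ← Finset.smul_sum]
    have h2 : S.op (a ⊗ₜ b) = a ⊗ₜ b - (2 : k) • u (a ⊗ₜ b) • ∑ i, x i ⊗ₜ[k] z i := by
      rw [← this, sub_sub_cancel]
    rw [h2]
    module

variable [FiniteDimensional k V] {F : RankTwoForm k V (Fin n)} {x : Module.Basis (Fin n) k V}
  (he : F.e = x)

omit [CharZero k] [FiniteDimensional k V] in
include he in
theorem B_f_apply (j : Fin n) (a : V) : F.B (F.f j) a = x.coord j a := by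
  have := congrArg (x.coord j) (F.sum_left a)
  simp only [he, map_sum, map_smul, Module.Basis.coord_apply, Module.Basis.repr_self,
    smul_eq_mul] at this
  rw [Module.Basis.coord_apply, ← this]
  simp [Finsupp.single_apply]

omit [CharZero k] [FiniteDimensional k V] in
include he in
theorem B_f_e (i j : Fin n) : F.B (F.f i) (F.e j) = if i = j then 1 else 0 := by
  rw [B_f_apply he, he, Module.Basis.coord_apply, Module.Basis.repr_self, Finsupp.single_apply]
  simp [eq_comm]

variable {S : Symmetry k V}
  (hS : ∀ x y, S.op (x ⊗ₜ y) = x ⊗ₜ y + F.B x y • ∑ i, F.e i ⊗ₜ[k] F.f i)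

omit [CharZero k] [FiniteDimensional k V] in
include he in
theorem matUnit_eq (i j : Fin n) : Symmetry.matUnit x i j = F.op (F.e i) (F.f j) := by
  ext a
  rw [op_apply, B_f_apply he, he]
  rfl

omit [CharZero k] in
include he hS in
/-- The inverse of the matrix `C`, whose entries are `-B (e i) (f j)`. -/
theorem matB_apply (i j : Fin n) :
    S.matB x i j = -∑ a, F.B (F.e a) (F.e i) * F.B (F.f j) (F.f a) := by
  have hC : ∀ i j, S.matC x i j = -F.B (F.e i) (F.f j) := fun i j => by
    rw [Symmetry.matC, Matrix.of_apply, matUnit_eq he, str_op hS]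
  have : S.matB x = Matrix.of fun i j => -∑ a, F.B (F.e a) (F.e i) * F.B (F.f j) (F.f a) := by
    refine Matrix.inv_eq_right_inv ?_
    ext i l
    rw [Matrix.mul_apply, Matrix.one_apply]
    simp only [hC, Matrix.of_apply, neg_mul_neg, Finset.mul_sum]
    rw [Finset.sum_comm]
    have h1 : ∀ a, ∑ j, F.B (F.e i) (F.f j) * (F.B (F.e a) (F.e j) * F.B (F.f l) (F.f a)) =
        F.B (F.e i) (F.e a) * F.B (F.f l) (F.f a) := fun a => by
      have := F.sum_right_map (F.B (F.e i)) (F.e a)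
      rw [← this, Finset.sum_mul]
      refine Finset.sum_congr rfl fun j _ => ?_
      rw [smul_eq_mul]
      ring
    simp_rw [h1]
    have h2 := F.sum_right_map (F.B (F.f l)) (F.e i)
    simp only [smul_eq_mul] at h2
    rw [h2, B_f_e he]
    simp [eq_comm]
  rw [this, Matrix.of_apply]

omit [CharZero k] in
theorem sum_neg_sum_mul_smul {ι N : Type*} [Fintype ι] [AddCommGroup N] [Module k N]
    (p q : ι → ι → k) (T : ι → ι → ι → N) :
    ∑ i, ∑ j, ∑ l, (-∑ a, p a i * q j a) • T l i j =
      (-1 : k) • ∑ l, ∑ a, ∑ i, ∑ j, p a i • q j a • T l i j := by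
  simp only [neg_smul, Finset.sum_neg_distrib, Finset.sum_smul, mul_smul, one_smul]
  congr 1
  calc _ = ∑ i, ∑ l, ∑ j, ∑ a, p a i • q j a • T l i j :=
        Finset.sum_congr rfl fun i _ => Finset.sum_comm
    _ = ∑ l, ∑ i, ∑ j, ∑ a, p a i • q j a • T l i j := Finset.sum_comm
    _ = ∑ l, ∑ i, ∑ a, ∑ j, p a i • q j a • T l i j :=
        Finset.sum_congr rfl fun l _ => Finset.sum_congr rfl fun i _ => Finset.sum_comm
    _ = _ := Finset.sum_congr rfl fun l _ => Finset.sum_comm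

omit [CharZero k] in
include he hS in
theorem casimirTensor_eq : S.casimirTensor x = (-1 : k) • F.nestNest S := by
  have hg : ∀ i j, S.slGen x i j = F.slOp S (F.e i) (F.f j) := fun i j => by
    rw [Symmetry.slGen, matUnit_eq he, slOp_apply]
  have h1 : ∀ l a, F.slOp S (F.e l) (F.e a) ⊗ₜ[k] F.slOp S (F.f a) (F.f l) =
      ∑ i, ∑ j, F.B (F.e a) (F.e i) • F.B (F.f j) (F.f a) •
        (F.slOp S (F.e l) (F.f i) ⊗ₜ[k] F.slOp S (F.e j) (F.f l)) := by
    intro l a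
    have h2 := F.sum_right_map (F.slOp S (F.e l)) (F.e a)
    have h3 := F.sum_left_map ((F.slOp S).flip (F.f l)) (F.f a)
    simp only [LinearMap.flip_apply] at h3
    rw [← h2, ← h3, TensorProduct.sum_tmul]
    simp only [TensorProduct.tmul_sum, TensorProduct.tmul_smul, ← TensorProduct.smul_tmul']
    refine Finset.sum_congr rfl fun i _ => Finset.sum_congr rfl fun j _ => smul_comm _ _ _
  simp only [Symmetry.casimirTensor, hg, matB_apply he hS, nestNest_eq, nest_apply, h1]
  exact sum_neg_sum_mul_smul (fun a i => F.B (F.e a) (F.e i)) (fun j a => F.B (F.f j) (F.f a))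
    fun l i j => F.slOp S (F.e l) (F.f i) ⊗ₜ[k] F.slOp S (F.e j) (F.f l)

end Frame

end RankTwoForm

/-! ### The hyperboloid and its adjoint action -/

namespace Symmetry

variable {k V : Type*} [Field k] [AddCommGroup V] [Module k V] [FiniteDimensional k V]
  (S : Symmetry k V) {n : ℕ} (x : Module.Basis (Fin n) k V) (c : k)

/-- The product `sl ⊗ sl → A_c` of generators. -/
def genMul : S.sl ⊗[k] S.sl →ₗ[k] S.Hyperboloid x c :=
  LinearMap.mul' k _ ∘ₗ TensorProduct.map (S.gen x c) (S.gen x c)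

variable {S x c}

theorem mkAlgHom_quadratic (t : S.sl ⊗[k] S.sl) :
    RingQuot.mkAlgHom k (S.HyperboloidRel x c) (S.quadratic t) = S.genMul x c t := by
  induction t using TensorProduct.induction_on with
  | zero => simp
  | tmul X Y => simp [quadratic, genMul, gen]
  | add s t hs ht => simp only [map_add, hs, ht]

theorem genMul_slTwist (t : S.sl ⊗[k] S.sl) :
    S.genMul x c (S.slTwist t) = S.genMul x c t := by
  rw [← mkAlgHom_quadratic, ← mkAlgHom_quadratic]
  exact (RingQuot.mkAlgHom_rel k (HyperboloidRel.comm t)).symm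

theorem genMul_casimirTensor :
    S.genMul x c (S.casimirTensor x) = algebraMap k _ c := by
  rw [← mkAlgHom_quadratic, ← AlgHom.commutes (RingQuot.mkAlgHom k (S.HyperboloidRel x c))]
  exact RingQuot.mkAlgHom_rel k HyperboloidRel.quadric

theorem hyperboloid_eq_top (N : Submodule k (S.Hyperboloid x c)) (h1 : 1 ∈ N)
    (hmul : ∀ X, ∀ a ∈ N, S.gen x c X * a ∈ N) : N = ⊤ :=
  eq_top_of_one_mem_of_mul_mem (RingQuot.mkAlgHom k (S.HyperboloidRel x c))
    (RingQuot.mkAlgHom_surjective k _) N h1 hmul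

/-- An adjoint action is unique, since the twisted Leibniz rule determines it on products of
generators. -/
theorem IsAdjointAction.unique {ρ ρ' : S.sl →ₗ[k] Module.End k (S.Hyperboloid x c)}
    (h : S.IsAdjointAction x ρ) (h' : S.IsAdjointAction x ρ') : ρ' = ρ := by
  have key : (⨅ X, LinearMap.eqLocus (ρ' X) (ρ X) : Submodule k (S.Hyperboloid x c)) = ⊤ := by
    refine hyperboloid_eq_top _ ?_ fun Y a ha => ?_
    · simp only [Submodule.mem_iInf, LinearMap.mem_eqLocus]
      exact fun X => (h'.map_one X).trans (h.map_one X).symm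
    · simp only [Submodule.mem_iInf, LinearMap.mem_eqLocus] at ha ⊢
      intro X
      rw [h.leibniz, h'.leibniz]
      congr 1
      induction S.slTwist (X ⊗ₜ Y) using TensorProduct.induction_on with
      | zero => simp
      | tmul Y' X' => simp [ha]
      | add s t hs ht => simp only [map_add, LinearMap.add_apply, hs, ht]
  refine LinearMap.ext fun X => LinearMap.ext fun a => ?_
  have := key.ge (Submodule.mem_top (x := a))
  simp only [Submodule.mem_iInf, LinearMap.mem_eqLocus] at this
  exact this X

end Symmetry

namespace RankTwoForm

variable {k V : Type*} [Field k] [CharZero k] [AddCommGroup V] [Module k V]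
  [FiniteDimensional k V] {n : ℕ} {F : RankTwoForm k V (Fin n)} {x : Module.Basis (Fin n) k V}
  (he : F.e = x) {S : Symmetry k V}
  (hS : ∀ x y, S.op (x ⊗ₜ y) = x ⊗ₜ y + F.B x y • ∑ i, F.e i ⊗ₜ[k] F.f i) (c : k)

variable (F S x) in
/-- The generators of the hyperboloid, indexed by `V ⊗ V`. -/
def hypGen : V →ₗ[k] V →ₗ[k] S.Hyperboloid x c := (F.slOp S).compr₂ (S.gen x c)

include hS in
theorem sum_hypGen_e_f : ∑ i, F.hypGen x S c (F.e i) (F.f i) = 0 := by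
  simp only [hypGen, LinearMap.compr₂_apply, ← map_sum, sum_slOp_e_f hS, map_zero]

omit [AddCommGroup V] [Module k V] [FiniteDimensional k V] in
/-- The linear algebra behind `sum_hypGen_mul_hypGen`: `m` and `g` stand for the products of
`nestNest` and `nest`. It is stated for additive monoids, to be applicable to the module structure
of a quotient `RingQuot`. -/
theorem eq_smul_of_neg_add_smul_eq_self {N : Type*} [AddCommMonoid N] [Module k N] {g m o : N}
    {b c : k} (hm : (-1 : k) • m = c • o) (hg : (-1 : k) • g + (-b) • m = g) :
    g = (c / 2 * b) • o := by
  let _ : AddCommGroup N := Module.addCommMonoidToAddCommGroup k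
  have h1 : (2 : k) • g = (c * b) • o := by
    calc (2 : k) • g = b • ((-1 : k) • m) - ((-1 : k) • g + (-b) • m) + g := by module
      _ = _ := by rw [hg, hm]; module
  rw [← inv_smul_smul₀ (two_ne_zero (α := k)) g, h1, smul_smul]
  congr 1
  ring

include he hS in
/-- The relations of the hyperboloid amount to the statement that the matrix of its generators
has the square `c / 2`. -/
theorem sum_hypGen_mul_hypGen (y z : V) :
    ∑ i, F.hypGen x S c y (F.e i) * F.hypGen x S c (F.f i) z =
      algebraMap k _ (c / 2 * F.B y z) := by
  have h1 := S.genMul_slTwist (x := x) (c := c) (F.nest S y z)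
  have h2 := S.genMul_casimirTensor (x := x) (c := c)
  rw [casimirTensor_eq he hS, map_smul, Algebra.algebraMap_eq_smul_one] at h2
  rw [slTwist_nest hS, map_add, map_smul, map_smul] at h1
  have h3 : S.genMul x c (F.nest S y z) =
      ∑ i, F.hypGen x S c y (F.e i) * F.hypGen x S c (F.f i) z := mul_map_nest _ _ _ _
  rw [← h3, Algebra.algebraMap_eq_smul_one]
  exact eq_smul_of_neg_add_smul_eq_self h2 h1

variable (F S) in
/-- The action of `sl(V_S)`, as the space of generators of the hyperboloid, on the even part. -/
def mulSl : S.sl →ₗ[k] Module.End k F.evenPart := F.ofBilin S (F.mulEven c)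

variable (F S) in
/-- The adjoint action of `sl(V_S)` on the even part. -/
def adSl : S.sl →ₗ[k] Module.End k F.evenPart := F.ofBilin S F.adEven

include hS in
theorem mulSl_slOp (y z : V) : F.mulSl S c (F.slOp S y z) = F.mulEven c y z :=
  ofBilin_slOp hS (sum_mulEven_e_f c) y z

include hS in
theorem adSl_slOp (y z : V) : F.adSl S (F.slOp S y z) = F.adEven y z :=
  ofBilin_slOp hS sum_adEven_e_f y z

include hS in
theorem mul_mulSl_nest (y z : V) :
    LinearMap.mul' k (Module.End k F.evenPart) (TensorProduct.map (F.mulSl S c) (F.mulSl S c)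
      (F.nest S y z)) = (c / 2 * F.B y z) • 1 := by
  rw [mul_map_nest]
  simp_rw [mulSl_slOp hS]
  exact sum_mulEven_mulEven c y z

include hS in
theorem mul_mulSl_nestNest :
    LinearMap.mul' k (Module.End k F.evenPart) (TensorProduct.map (F.mulSl S c) (F.mulSl S c)
      (F.nestNest S)) = -(c • 1) := by
  simp_rw [nestNest_eq, map_sum, mul_mulSl_nest hS, ← Finset.sum_smul, ← Finset.mul_sum,
    F.trace]
  module

include hS in
theorem mul_mulSl_slTwist :
    LinearMap.mul' k (Module.End k F.evenPart) ∘ₗ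
      TensorProduct.map (F.mulSl S c) (F.mulSl S c) ∘ₗ S.slTwist =
    LinearMap.mul' k (Module.End k F.evenPart) ∘ₗ
      TensorProduct.map (F.mulSl S c) (F.mulSl S c) := by
  refine slTensor_hom_ext hS fun x y z w => ?_
  simp only [LinearMap.comp_apply, slTwist_slOp hS, map_add, map_smul,
    mul_mulSl_nest hS, mul_mulSl_nestNest hS]
  module

include he hS in
/-- The action of the hyperboloid on the even part of the symmetric algebra. -/
theorem exists_hyperboloid_action : ∃ Θ : S.Hyperboloid x c →ₐ[k] Module.End k F.evenPart,
    ∀ X, Θ (S.gen x c X) = F.mulSl S c X := by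
  have hq : ∀ t, TensorAlgebra.lift k (F.mulSl S c) (S.quadratic t) =
      LinearMap.mul' k (Module.End k F.evenPart) (TensorProduct.map (F.mulSl S c)
        (F.mulSl S c) t) := fun t => by
    induction t using TensorProduct.induction_on with
    | zero => simp
    | tmul X Y => simp [Symmetry.quadratic]
    | add s t hs ht => simp only [map_add, hs, ht]
  refine ⟨RingQuot.liftAlgHom k ⟨TensorAlgebra.lift k (F.mulSl S c), ?_⟩,
    fun X => ?_⟩
  · rintro _ _ (t | _)
    · rw [hq, hq]
      exact (LinearMap.congr_fun (mul_mulSl_slTwist hS c) t).symm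
    · rw [hq, casimirTensor_eq he hS, map_smul, map_smul, mul_mulSl_nestNest hS,
        AlgHom.commutes, Algebra.algebraMap_eq_smul_one]
      module
  · change RingQuot.liftAlgHom k _ (RingQuot.mkAlgHom k _ _) = _
    rw [RingQuot.liftAlgHom_mkAlgHom_apply, TensorAlgebra.lift_ι_apply]

include hS in
/-- The twisted Leibniz rule for operators on the even part. -/
theorem adSl_mul_mulSl (X Y : S.sl) :
    F.adSl S X * F.mulSl S c Y =
      F.mulSl S c (S.slBracket (X ⊗ₜ Y)) +
      LinearMap.mul' k (Module.End k F.evenPart) (TensorProduct.map (F.mulSl S c) (F.adSl S)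
        (S.slTwist (X ⊗ₜ Y))) := by
  have h : LinearMap.mul' k (Module.End k F.evenPart) ∘ₗ
      TensorProduct.map (F.adSl S) (F.mulSl S c) =
      F.mulSl S c ∘ₗ S.slBracket + LinearMap.mul' k (Module.End k F.evenPart) ∘ₗ
        TensorProduct.map (F.mulSl S c) (F.adSl S) ∘ₗ S.slTwist := by
    refine slTensor_hom_ext hS fun x y z w => ?_
    simp only [LinearMap.comp_apply, LinearMap.add_apply, slTwist_slOp hS, slBracket_slOp hS,
      map_add, map_smul, TensorProduct.map_tmul, LinearMap.mul'_apply, mul_map_nest,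
      mul_map_nestNest, mulSl_slOp hS, adSl_slOp hS, sum_sum_mulEven_adEven, adEven_mul_mulEven,
      smul_zero, add_zero]
  simpa using LinearMap.congr_fun h (X ⊗ₜ Y)

include he hS in
/-- The hyperboloid is identified with the even part of the symmetric algebra in such a way that
the left multiplications by its generators become the operators `mulEven`. -/
theorem exists_hyperboloid_equiv : ∃ Φ : S.Hyperboloid x c ≃ₗ[k] F.evenPart, Φ 1 = evenOne ∧
    ∀ X a, Φ (S.gen x c X * a) = F.mulSl S c X (Φ a) := by
  obtain ⟨Θ, hΘ⟩ := exists_hyperboloid_action he hS c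
  have hbij := orbit_bijective (P := F.hypGen x S c) (sum_hypGen_e_f hS c)
    (sum_hypGen_mul_hypGen he hS c) (fun N h1 hN => ?_) Θ fun y z => ?_
  · refine ⟨LinearEquiv.ofBijective _ hbij, ?_, fun X a => ?_⟩
    · simp
    · simp [hΘ]
  · refine Symmetry.hyperboloid_eq_top N h1 fun X a ha => ?_
    rw [← sum_slOp hS X, map_sum, Finset.sum_mul]
    exact Submodule.sum_mem _ fun i _ => hN _ _ _ ha
  · rw [hypGen, LinearMap.compr₂_apply, hΘ, mulSl_slOp hS]

include he hS in
/-- The adjoint action exists, and in the identification of the hyperboloid with the even part of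
the symmetric algebra its Casimir operator is a function of the degree. -/
theorem exists_adjointAction : ∃ (Φ : S.Hyperboloid x c ≃ₗ[k] F.evenPart)
    (ρ : S.sl →ₗ[k] Module.End k (S.Hyperboloid x c)), S.IsAdjointAction x ρ ∧
      ∀ (m : k) (a : S.Hyperboloid x c), (Φ a : F.SymAlg) ∈ F.deg m →
        S.casimirOp x ρ a = (2⁻¹ * m * (m + 2)) • a := by
  obtain ⟨Φ, hΦ1, hΦ⟩ := exists_hyperboloid_equiv he hS c
  let ρ : S.sl →ₗ[k] Module.End k (S.Hyperboloid x c) :=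
    Φ.symm.conj.toLinearMap ∘ₗ F.adSl S
  have hρ : ∀ X a, Φ (ρ X a) = F.adSl S X (Φ a) := fun X a => by
    simp [ρ, LinearEquiv.conj_apply]
  refine ⟨Φ, ρ, ⟨fun X => ?_, fun X Y a => ?_⟩, fun m a ha => ?_⟩
  · apply Φ.injective
    rw [hρ, hΦ1, adSl, ofBilin_apply, LinearMap.sum_apply, map_zero]
    exact Finset.sum_eq_zero fun i _ => adEven_one _ _
  · apply Φ.injective
    have hτ : ∀ τ : S.sl ⊗[k] S.sl, Φ (LinearMap.mul' k (Module.End k (S.Hyperboloid x c))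
        (TensorProduct.map ((Algebra.lmul k (S.Hyperboloid x c)).toLinearMap ∘ₗ S.gen x c) ρ τ) a)
        = LinearMap.mul' k (Module.End k F.evenPart) (TensorProduct.map (F.mulSl S c)
          (F.adSl S) τ) (Φ a) := fun τ => by
      induction τ using TensorProduct.induction_on with
      | zero => simp
      | tmul Y X => simp [hΦ, hρ]
      | add s t hs ht => simp only [map_add, LinearMap.add_apply, hs, ht]
    rw [hρ, hΦ, map_add, hΦ, hτ]
    exact LinearMap.congr_fun (adSl_mul_mulSl hS c X Y) (Φ a)
  · apply Φ.injective
    have hτ : ∀ τ : S.sl ⊗[k] S.sl, Φ (LinearMap.mul' k (Module.End k (S.Hyperboloid x c))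
        (TensorProduct.map ρ ρ τ) a) = LinearMap.mul' k (Module.End k F.evenPart) (TensorProduct.map
          (F.adSl S) (F.adSl S) τ) (Φ a) := fun τ => by
      induction τ using TensorProduct.induction_on with
      | zero => simp
      | tmul Y X => simp [hρ]
      | add s t hs ht => simp only [map_add, LinearMap.add_apply, hs, ht]
    rw [Symmetry.casimirOp, hτ, casimirTensor_eq he hS, map_smul, map_smul, mul_map_nestNest]
    refine Subtype.ext ?_
    simp only [adSl_slOp hS, LinearMap.smul_apply, LinearMap.sum_apply,
      Module.End.mul_apply, Submodule.coe_sum, coe_adEven,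
      sum_sum_adOp_adOp ha, map_smul, Submodule.coe_smul]
    module

end RankTwoForm

/-! ### The recurrence of the dimensions -/

section Asymptotics

/-- The dimensions `d m` determined by `d 0 = 1`, `d 1 = n`, `d m + d (m + 2) = n * d (m + 1)`
in closed form. -/
theorem closed_form_of_recurrence {n : ℕ} {α₁ α₂ : ℝ} (hα₁ : 1 - (n : ℝ) * α₁ + α₁ ^ 2 = 0)
    (hα₂ : 1 - (n : ℝ) * α₂ + α₂ ^ 2 = 0) (hα : α₁ < α₂) {d : ℕ → ℕ} (h0 : d 0 = 1) (h1 : d 1 = n)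
    (h2 : ∀ m, d m + d (m + 2) = n * d (m + 1)) (m : ℕ) :
    (d m : ℝ) = (α₂ ^ (m + 1) - α₁ ^ (m + 1)) / (α₂ - α₁) := by
  have hne : α₂ - α₁ ≠ 0 := (sub_pos.2 hα).ne'
  have hsum : α₁ + α₂ = n := by
    have : (α₂ - α₁) * (α₁ + α₂ - n) = 0 := by linear_combination hα₂ - hα₁
    rcases mul_eq_zero.1 this with h | h
    · exact absurd h hne
    · linarith
  suffices H : ∀ m, (d m : ℝ) * (α₂ - α₁) = α₂ ^ (m + 1) - α₁ ^ (m + 1) ∧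
      (d (m + 1) : ℝ) * (α₂ - α₁) = α₂ ^ (m + 2) - α₁ ^ (m + 2) from
    (eq_div_iff hne).2 (H m).1
  intro m
  induction m with
  | zero =>
    rw [h0, zero_add, h1, ← hsum]
    constructor <;> push_cast <;> ring
  | succ m ih =>
    refine ⟨ih.2, ?_⟩
    have h := congrArg (Nat.cast (R := ℝ)) (h2 m)
    push_cast at h
    have : (d (m + 2) : ℝ) = n * d (m + 1) - d m := by linarith
    rw [show m + 1 + 1 = m + 2 from rfl, this]
    linear_combination (n : ℝ) * ih.2 - ih.1 + α₁ ^ (m + 1) * hα₁ - α₂ ^ (m + 1) * hα₂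

/-- The Clebsch-Gordan identity `d m ^ 2 = ∑ d (2 r)`, `r ≤ m`. -/
theorem sum_even_eq_sq {α₁ α₂ : ℝ} (hprod : α₁ * α₂ = 1) (hα : α₁ < α₂) {d : ℕ → ℝ}
    (hd : ∀ m, d m = (α₂ ^ (m + 1) - α₁ ^ (m + 1)) / (α₂ - α₁)) (m : ℕ) :
    ∑ r ∈ Finset.range (m + 1), d (2 * r) = d m ^ 2 := by
  have hne : α₂ - α₁ ≠ 0 := (sub_pos.2 hα).ne'
  induction m with
  | zero => simp [hd, hne]
  | succ m ih =>
    rw [Finset.sum_range_succ, ih, hd, hd, hd]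
    have hp : α₁ ^ (m + 1) * α₂ ^ (m + 1) = 1 := by rw [← mul_pow, hprod, one_pow]
    field_simp
    rw [show 2 * (m + 1) + 1 = (m + 1) + (m + 1) + 1 by ring]
    simp only [pow_succ _ (m + 1), pow_add _ (m + 1) (m + 1), pow_add _ (m + 1 + (m + 1)) 1]
    generalize α₁ ^ (m + 1) = a at *
    generalize α₂ ^ (m + 1) = b at *
    linear_combination (2 * a * b - a ^ 2 - b ^ 2) * hprod

end Asymptotics

/-! ### Counting eigenvalues, and limits of counting functions -/

section Counting

theorem finite_sup_and_finrank_sup {k A : Type*} [Field k] [AddCommGroup A] [Module k A]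
    {W : ℕ → Submodule k A} (hW : iSupIndep W) (hfin : ∀ r, Module.Finite k (W r)) (m : ℕ) :
    Module.Finite k ((Finset.range m).sup W : Submodule k A) ∧
      Module.finrank k ((Finset.range m).sup W : Submodule k A) =
        ∑ r ∈ Finset.range m, Module.finrank k (W r) := by
  induction m with
  | zero =>
    rw [Finset.range_zero, Finset.sup_empty, Finset.sum_empty]
    exact ⟨inferInstance, finrank_bot k A⟩
  | succ m ih =>
    have := ih.1
    have := hfin m
    rw [Finset.range_add_one, Finset.sup_insert, Finset.sum_insert Finset.notMem_range_self]
    refine ⟨Submodule.finite_sup _ _, ?_⟩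
    have h := Submodule.finrank_sup_add_finrank_inf_eq (W m) ((Finset.range m).sup W)
    have hd : Disjoint (W m) ((Finset.range m).sup W) := by
      rw [Finset.sup_eq_iSup]
      exact hW.disjoint_biSup (y := (Finset.range m : Set ℕ)) (by simp)
    rwa [hd.eq_bot, finrank_bot, add_zero, ih.2] at h

/-- The eigenvalues `2 r (r + 1)` of the Casimir operator. -/
def casimirValue (r : ℕ) : ℝ := 2 * r * (r + 1)

theorem casimirValue_strictMono : StrictMono casimirValue := by
  intro r s h
  have h' : (r : ℝ) < s := by exact_mod_cast h
  have hr : (0 : ℝ) ≤ r := r.cast_nonneg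
  unfold casimirValue
  nlinarith

/-- The largest `r` with `2 r (r + 1) ≤ t`, for `t ≥ 0`. -/
def level (t : ℝ) : ℕ := ⌊(√(2 * t + 1) - 1) / 2⌋₊

theorem level_le_iff {t : ℝ} (ht : 0 ≤ t) (r : ℕ) : r ≤ level t ↔ casimirValue r ≤ t := by
  have h1 : 1 ≤ √(2 * t + 1) := Real.one_le_sqrt.2 (by linarith)
  rw [level, Nat.le_floor_iff (by linarith), le_div_iff₀ two_pos, le_sub_iff_add_le,
    Real.le_sqrt (by positivity) (by linarith), casimirValue]
  constructor <;> intro h <;> nlinarith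

theorem two_mul_level_add_one_le {t : ℝ} (ht : 0 ≤ t) : 2 * (level t : ℝ) + 1 ≤ √(2 * t + 1) := by
  have h1 : 1 ≤ √(2 * t + 1) := Real.one_le_sqrt.2 (by linarith)
  have := Nat.floor_le (a := (√(2 * t + 1) - 1) / 2) (by linarith)
  rw [level]
  linarith

theorem lt_two_mul_level_add_three (t : ℝ) : √(2 * t + 1) < 2 * (level t : ℝ) + 3 := by
  have := Nat.lt_floor_add_one ((√(2 * t + 1) - 1) / 2)
  rw [level]
  linarith

variable {k A : Type*} [RCLike k] [AddCommGroup A] [Module k A] {C : Module.End k A}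
  {W : ℕ → Submodule k A} (hW : ∀ r, ∀ a ∈ W r, C a = ((casimirValue r : ℝ) : k) • a)
  (htop : ⨆ r, W r = ⊤)

theorem casimirValue_cast_injective : Function.Injective fun r => ((casimirValue r : ℝ) : k) :=
  RCLike.ofReal_injective.comp casimirValue_strictMono.injective

include hW htop

theorem eigenspace_casimirValue (r : ℕ) : C.eigenspace ((casimirValue r : ℝ) : k) = W r :=
  eigenspace_eq_of_iSup_eq_top casimirValue_cast_injective
    (fun r a ha => Module.End.mem_eigenspace_iff.2 (hW r a ha)) htop r

theorem exists_real_of_hasEigenvalue {μ : k} (hμ : C.HasEigenvalue μ) :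
    ∃ r : ℝ, μ = (r : k) := by
  by_contra! h
  exact hμ (eigenspace_eq_bot_of_iSup_eq_top
    (fun r a ha => Module.End.mem_eigenspace_iff.2 (hW r a ha)) htop fun r => (h _).symm)

theorem iSupIndep_of_casimirValue : iSupIndep W := by
  have := C.eigenspaces_iSupIndep.comp (casimirValue_cast_injective (k := k))
  have h : C.eigenspace ∘ (fun r => ((casimirValue r : ℝ) : k)) = W :=
    funext fun r => eigenspace_casimirValue hW htop r
  rwa [h] at this

theorem eigenspacesLE_of_nonneg {t : ℝ} (ht : 0 ≤ t) :
    eigenspacesLE C t = (Finset.range (level t + 1)).sup W := by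
  refine le_antisymm (iSup₂_le fun μ hμ => ?_) (Finset.sup_le fun r hr => ?_)
  · by_cases h : ∃ r, casimirValue r = μ
    · obtain ⟨r, rfl⟩ := h
      rw [eigenspace_casimirValue hW htop]
      exact Finset.le_sup (f := W)
        (Finset.mem_range.2 (Nat.lt_succ_of_le ((level_le_iff ht r).2 hμ)))
    · rw [eigenspace_eq_bot_of_iSup_eq_top
        (fun r a ha => Module.End.mem_eigenspace_iff.2 (hW r a ha)) htop
        fun r hr => h ⟨r, RCLike.ofReal_injective hr⟩]
      exact bot_le
  · rw [← eigenspace_casimirValue hW htop]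
    exact le_iSup₂ (f := fun (μ : ℝ) (_ : μ ≤ t) => C.eigenspace (μ : k)) (casimirValue r)
      ((level_le_iff ht r).1 (Nat.le_of_lt_succ (Finset.mem_range.1 hr)))

theorem finite_eigenspacesLE (hfin : ∀ r, Module.Finite k (W r)) (t : ℝ) :
    FiniteDimensional k (eigenspacesLE C t) := by
  have h0 : 0 ≤ max t 0 := le_max_right _ _
  have hle : eigenspacesLE C t ≤ eigenspacesLE C (max t 0) :=
    iSup₂_le fun μ hμ => le_iSup₂ (f := fun (μ : ℝ) (_ : μ ≤ max t 0) => C.eigenspace (μ : k)) μ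
      (hμ.trans (le_max_left _ _))
  rw [eigenspacesLE_of_nonneg hW htop h0] at hle
  have := (finite_sup_and_finrank_sup (iSupIndep_of_casimirValue hW htop) hfin
    (level (max t 0) + 1)).1
  exact Submodule.finiteDimensional_of_le hle

theorem eigenvalueCount_of_nonneg (hfin : ∀ r, Module.Finite k (W r)) {t : ℝ} (ht : 0 ≤ t) :
    eigenvalueCount C t = ∑ r ∈ Finset.range (level t + 1), Module.finrank k (W r) := by
  rw [eigenvalueCount, eigenspacesLE_of_nonneg hW htop ht]
  exact (finite_sup_and_finrank_sup (iSupIndep_of_casimirValue hW htop) hfin _).2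

end Counting

section Limits

/-- `√(N² - a) - N` tends to zero. -/
theorem tendsto_sqrt_sub (a : ℝ) :
    Tendsto (fun N : ℝ => √(N ^ 2 - a) - N) atTop (𝓝 0) := by
  have h1 : Tendsto (fun N : ℝ => -a / (√(N ^ 2 - a) + N)) atTop (𝓝 0) :=
    tendsto_const_nhds.div_atTop
      (tendsto_atTop_mono (fun N => le_add_of_nonneg_left (Real.sqrt_nonneg _)) tendsto_id)
  refine h1.congr' ?_
  filter_upwards [eventually_gt_atTop 0, eventually_ge_atTop (|a| + 1)] with N hN hNa
  have h2 : 0 ≤ N ^ 2 - a := by nlinarith [le_abs_self a, abs_nonneg a]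
  rw [div_eq_iff (by positivity)]
  nlinarith [Real.sq_sqrt h2]

theorem limsup_eq_of_tendsto {f g : ℝ → ℝ} {u : ℕ → ℝ} {b : ℝ} (hfg : ∀ᶠ t in atTop, f t ≤ g t)
    (hg : Tendsto g atTop (𝓝 b)) (hu : Tendsto u atTop atTop)
    (hfu : Tendsto (fun m => f (u m)) atTop (𝓝 b)) :
    limsup (fun t => (f t : EReal)) atTop = b := by
  refine le_antisymm ?_ ?_
  · rw [← (EReal.tendsto_coe.2 hg).limsup_eq]
    exact limsup_le_limsup (hfg.mono fun t ht => EReal.coe_le_coe_iff.2 ht)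
  · rw [← (EReal.tendsto_coe.2 hfu).limsup_eq]
    exact limsup_le_limsup_of_le (f := map u atTop) (u := fun t => (f t : EReal)) hu

theorem liminf_eq_of_tendsto {f g : ℝ → ℝ} {u : ℕ → ℝ} {b : ℝ} (hfg : ∀ᶠ t in atTop, g t ≤ f t)
    (hg : Tendsto g atTop (𝓝 b)) (hu : Tendsto u atTop atTop)
    (hfu : Tendsto (fun m => f (u m)) atTop (𝓝 b)) :
    liminf (fun t => (f t : EReal)) atTop = b := by
  refine le_antisymm ?_ ?_
  · rw [← (EReal.tendsto_coe.2 hfu).liminf_eq]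
    exact liminf_le_liminf_of_le (g := map u atTop) (u := fun t => (f t : EReal)) hu
  · rw [← (EReal.tendsto_coe.2 hg).liminf_eq]
    exact liminf_le_liminf (hfg.mono fun t ht => EReal.coe_le_coe_iff.2 ht)

theorem tendsto_level : Tendsto level atTop atTop := by
  refine tendsto_nat_floor_atTop.comp ?_
  refine Tendsto.atTop_div_const two_pos (tendsto_atTop_add_const_right _ _ ?_)
  exact Real.tendsto_sqrt_atTop.comp
    (tendsto_atTop_add_const_right _ _ (tendsto_id.const_mul_atTop two_pos))

theorem level_eq {t : ℝ} {m : ℕ} (h1 : 2 * (m : ℝ) + 1 ≤ √(2 * t + 1))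
    (h2 : √(2 * t + 1) < 2 * (m : ℝ) + 3) : level t = m := by
  rw [level, Nat.floor_eq_iff (by linarith [m.cast_nonneg (α := ℝ)])]
  constructor <;> linarith

/-- The growth of a counting function which jumps at the numbers `2 r (r + 1)`, to values
`D r ∼ γ q ^ (2 r + 2)`. With `r = level t` one has `2 r + 1 ≤ √(2 t + 1) < 2 r + 3`, and `√(2 t)`
differs from `√(2 t + 1)` by an arbitrarily small amount; the upper limit is reached at the jumps
and the lower limit just before them. -/
theorem limsup_liminf_of_level {N : ℝ → ℝ} {D : ℕ → ℝ} {q γ : ℝ} (hq : 1 < q) (hγ : 0 < γ)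
    (hN : ∀ t, 0 ≤ t → N t = D (level t)) (hD0 : ∀ r, 0 ≤ D r)
    (hD : Tendsto (fun r : ℕ => D r / q ^ (2 * (r : ℝ) + 2)) atTop (𝓝 γ)) :
    (∃ β : ℝ, 0 < β ∧
      limsup (fun t : ℝ => ((N t / q ^ (√(2 * t) + 2) : ℝ) : EReal)) atTop = (β : EReal) ∧
      liminf (fun t : ℝ => ((N t / q ^ √(2 * t) : ℝ) : EReal)) atTop = (β : EReal)) ∧
    ¬ ∃ L : EReal, Tendsto (fun t : ℝ => ((N t / q ^ √(2 * t) : ℝ) : EReal)) atTop (𝓝 L) := by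
  have hq0 : 0 < q := one_pos.trans hq
  -- the quotient `D r / q ^ g r` converges as soon as `g r - 2 r` does
  have hlim : ∀ (g : ℕ → ℝ) (b : ℝ), Tendsto (fun r : ℕ => g r - 2 * (r : ℝ)) atTop (𝓝 b) →
      Tendsto (fun r : ℕ => D r / q ^ g r) atTop (𝓝 (γ * q ^ (2 - b))) := by
    intro g b hg
    have h1 : Tendsto (fun r : ℕ => q ^ (2 - (g r - 2 * (r : ℝ)))) atTop (𝓝 (q ^ (2 - b))) :=
      (Real.continuousAt_const_rpow hq0.ne').tendsto.comp (tendsto_const_nhds.sub hg)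
    refine (hD.mul h1).congr fun r => ?_
    rw [div_mul_eq_mul_div, div_eq_div_iff (by positivity) (by positivity), mul_assoc,
      ← Real.rpow_add hq0]
    congr 2
    ring
  have hcast : Tendsto (fun r : ℕ => (r : ℝ)) atTop atTop := tendsto_natCast_atTop_atTop
  have hup : Tendsto (fun r : ℕ => √((2 * (r : ℝ) + 1) ^ 2 - 1) - 2 * (r : ℝ)) atTop (𝓝 1) := by
    have := ((tendsto_sqrt_sub 1).comp (tendsto_atTop_add_const_right _ 1
      (hcast.const_mul_atTop two_pos))).add_const 1
    rw [zero_add] at this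
    exact this.congr fun r => by simp only [Function.comp_apply]; ring
  have hlo : Tendsto (fun r : ℕ => √((2 * (r : ℝ) + 3) ^ 2 - 3) - 2 * (r : ℝ)) atTop (𝓝 3) := by
    have := ((tendsto_sqrt_sub 3).comp (tendsto_atTop_add_const_right _ 3
      (hcast.const_mul_atTop two_pos))).add_const 3
    rw [zero_add] at this
    exact this.congr fun r => by simp only [Function.comp_apply]; ring
  -- `u r` is the `r`-th jump, and `w r` is one less than the next one
  let u : ℕ → ℝ := fun r => ((2 * (r : ℝ) + 1) ^ 2 - 1) / 2
  let w : ℕ → ℝ := fun r => ((2 * (r : ℝ) + 3) ^ 2 - 3) / 2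
  have hu0 : ∀ r : ℕ, (r : ℝ) ≤ u r := fun r => by
    have : (0 : ℝ) ≤ r := r.cast_nonneg
    simp only [u]
    nlinarith
  have hw0 : ∀ r : ℕ, (r : ℝ) ≤ w r := fun r => by
    have : (0 : ℝ) ≤ r := r.cast_nonneg
    simp only [w]
    nlinarith
  have hu : Tendsto u atTop atTop := tendsto_atTop_mono hu0 hcast
  have hw : Tendsto w atTop atTop := tendsto_atTop_mono hw0 hcast
  have hNu : ∀ r, N (u r) = D r := fun r => by
    have hr : (0 : ℝ) ≤ r := r.cast_nonneg
    rw [hN _ (hr.trans (hu0 r)), level_eq (m := r)]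
    · rw [show 2 * u r + 1 = (2 * (r : ℝ) + 1) ^ 2 by simp only [u]; ring,
        Real.sqrt_sq (by positivity)]
    · rw [show 2 * u r + 1 = (2 * (r : ℝ) + 1) ^ 2 by simp only [u]; ring,
        Real.sqrt_sq (by positivity)]
      linarith
  have hNw : ∀ r, N (w r) = D r := fun r => by
    have hr : (0 : ℝ) ≤ r := r.cast_nonneg
    rw [hN _ (hr.trans (hw0 r)), level_eq (m := r)]
    · refine Real.le_sqrt_of_sq_le ?_
      simp only [w]
      nlinarith
    · rw [Real.sqrt_lt' (by positivity)]
      simp only [w]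
      nlinarith
  have h2u : ∀ r, 2 * u r = (2 * (r : ℝ) + 1) ^ 2 - 1 := fun r => by simp only [u]; ring
  have h2w : ∀ r, 2 * w r = (2 * (r : ℝ) + 3) ^ 2 - 3 := fun r => by simp only [w]; ring
  have hfu : Tendsto (fun r => N (u r) / q ^ √(2 * u r)) atTop (𝓝 (γ * q ^ (2 - 1 : ℝ))) := by
    simp_rw [hNu, h2u]
    exact hlim _ 1 hup
  have hfw : Tendsto (fun r => N (w r) / q ^ √(2 * w r)) atTop (𝓝 (γ * q ^ (2 - 3 : ℝ))) := by
    simp_rw [hNw, h2w]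
    exact hlim _ 3 hlo
  refine ⟨⟨γ * q ^ (2 - 3 : ℝ), by positivity, ?_, ?_⟩, ?_⟩
  · refine limsup_eq_of_tendsto
      (g := fun t => D (level t) / q ^ (√((2 * (level t : ℝ) + 1) ^ 2 - 1) + 2)) ?_ ?_ hu ?_
    · filter_upwards [eventually_ge_atTop 0] with t ht
      rw [hN t ht]
      have h1 := two_mul_level_add_one_le ht
      have h2 : (2 * (level t : ℝ) + 1) ^ 2 - 1 ≤ 2 * t := by
        rw [Real.le_sqrt (by positivity) (by linarith)] at h1
        linarith
      exact div_le_div_of_nonneg_left (hD0 _) (by positivity)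
        (Real.rpow_le_rpow_of_exponent_le hq.le (add_le_add_left (Real.sqrt_le_sqrt h2) 2))
    · refine (hlim (fun r => √((2 * (r : ℝ) + 1) ^ 2 - 1) + 2) 3 ?_).comp tendsto_level
      have := hup.add_const 2
      norm_num at this
      exact this.congr fun r => by ring
    · simp_rw [hNu, h2u]
      refine hlim (fun r => √((2 * (r : ℝ) + 1) ^ 2 - 1) + 2) 3 ?_
      have := hup.add_const 2
      norm_num at this
      exact this.congr fun r => by ring
  · refine liminf_eq_of_tendsto (g := fun t => D (level t) / q ^ (2 * (level t : ℝ) + 3))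
      ?_ ?_ hw hfw
    · filter_upwards [eventually_ge_atTop 0] with t ht
      rw [hN t ht]
      have h1 := lt_two_mul_level_add_three t
      have h2 : √(2 * t) ≤ √(2 * t + 1) := Real.sqrt_le_sqrt (by linarith)
      exact div_le_div_of_nonneg_left (hD0 _) (by positivity)
        (Real.rpow_le_rpow_of_exponent_le hq.le (h2.trans h1.le))
    · refine (hlim (fun r => 2 * (r : ℝ) + 3) 3 ?_).comp tendsto_level
      exact tendsto_const_nhds.congr fun r => by ring
  · rintro ⟨L, hL⟩
    have h1 := tendsto_nhds_unique (hL.comp hu) (EReal.tendsto_coe.2 hfu)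
    have h2 := tendsto_nhds_unique (hL.comp hw) (EReal.tendsto_coe.2 hfw)
    have h3 := EReal.coe_injective (h1.symm.trans h2)
    have h4 : q ^ (2 - 1 : ℝ) = q ^ (2 - 3 : ℝ) := mul_left_cancel₀ hγ.ne' h3
    have h5 := Real.rpow_lt_rpow_of_exponent_lt hq (show (2 - 3 : ℝ) < 2 - 1 by norm_num)
    exact h5.ne' h4

end Limits

section Growth

theorem tendsto_sq_div {α₁ α₂ : ℝ} (hprod : α₁ * α₂ = 1) (hα : α₁ < α₂) (hα₂ : 1 < α₂) {d : ℕ → ℝ}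
    (hd : ∀ m, d m = (α₂ ^ (m + 1) - α₁ ^ (m + 1)) / (α₂ - α₁)) :
    Tendsto (fun r : ℕ => d r ^ 2 / α₂ ^ (2 * (r : ℝ) + 2)) atTop (𝓝 (((α₂ - α₁) ^ 2)⁻¹)) := by
  have h0 : 0 < α₂ := one_pos.trans hα₂
  have h1 : Tendsto (fun r : ℕ => ((1 - (α₁ ^ 2) ^ (r + 1)) / (α₂ - α₁)) ^ 2) atTop
      (𝓝 (((1 - 0) / (α₂ - α₁)) ^ 2)) := by
    refine ((tendsto_const_nhds.sub ?_).div_const _).pow 2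
    refine (tendsto_pow_atTop_nhds_zero_of_lt_one (sq_nonneg _) ?_).comp (tendsto_add_atTop_nat 1)
    have : 0 < α₁ := pos_of_mul_pos_left (by rw [hprod]; exact one_pos) h0.le
    nlinarith
  have h2 : ((1 - 0) / (α₂ - α₁)) ^ 2 = ((α₂ - α₁) ^ 2)⁻¹ := by
    rw [sub_zero, one_div, inv_pow]
  rw [h2] at h1
  refine h1.congr fun r => ?_
  have hp : α₁ ^ (r + 1) * α₂ ^ (r + 1) = 1 := by rw [← mul_pow, hprod, one_pow]
  have hr : α₂ ^ (2 * (r : ℝ) + 2) = (α₂ ^ (r + 1)) ^ 2 := by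
    rw [← pow_mul, ← Real.rpow_natCast]
    congr 1
    push_cast
    ring
  rw [hr, hd, ← pow_mul, mul_comm 2, pow_mul, ← div_pow]
  congr 1
  have h3 : α₂ ^ (r + 1) ≠ 0 := by positivity
  rw [div_div, mul_comm (α₂ - α₁), ← div_div]
  congr 1
  field_simp
  linear_combination -(α₁ ^ (r + 1)) * hp

end Growth

/-! ### The growth of the number of eigenvalues -/

namespace RankTwoForm

variable {k V ι A : Type*} [Field k] [CharZero k] [AddCommGroup V] [Module k V] [Fintype ι]
  [AddCommGroup A] [Module k A] {F : RankTwoForm k V ι} (Φ : A ≃ₗ[k] F.evenPart)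

/-- The embedding of `A` into the symmetric algebra, for an identification of `A` with the even
part. -/
def evenEmbedding : A →ₗ[k] F.SymAlg := F.evenPart.subtype ∘ₗ Φ.toLinearMap

omit [CharZero k] in
theorem evenEmbedding_injective : Function.Injective (evenEmbedding Φ) :=
  Subtype.val_injective.comp Φ.injective

omit [CharZero k] in
theorem range_evenEmbedding : LinearMap.range (evenEmbedding Φ) = F.evenPart := by
  rw [evenEmbedding, LinearMap.range_comp_of_range_eq_top _ Φ.range, Submodule.range_subtype]

/-- The component of degree `2 r` of the even part, as a subspace of `A`. -/
def evenComponent (r : ℕ) : Submodule k A :=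
  (F.deg ((2 * r : ℕ) : k)).comap (evenEmbedding Φ)

theorem map_evenComponent (r : ℕ) :
    (evenComponent Φ r).map (evenEmbedding Φ) = F.deg ((2 * r : ℕ) : k) := by
  refine Submodule.map_comap_eq_self fun q hq => ?_
  rw [range_evenEmbedding]
  exact mem_evenPart (r := r) (by exact_mod_cast hq)

/-- The component of degree `2 r`, inside `A` and inside the symmetric algebra. -/
def evenComponentEquiv (r : ℕ) : evenComponent Φ r ≃ₗ[k] F.deg (((2 * r : ℕ) : k)) :=
  Submodule.equivMapOfInjective _ (evenEmbedding_injective Φ) _ ≪≫ₗ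
    LinearEquiv.ofEq _ _ (map_evenComponent Φ r)

theorem iSup_evenComponent : ⨆ r, evenComponent Φ r = ⊤ := by
  refine Submodule.map_injective_of_injective (evenEmbedding_injective Φ) ?_
  simp_rw [Submodule.map_iSup, map_evenComponent, Submodule.map_top, range_evenEmbedding, evenPart]
  push_cast
  rfl

end RankTwoForm

end TwistedHyperboloid

end

open TwistedHyperboloid

theorem proposition5p3 {k : Type*} [RCLike k] {V : Type*} [AddCommGroup V] [Module k V]
    [FiniteDimensional k V] {n : ℕ} (hn : 2 < n) (x : Module.Basis (Fin n) k V)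
    (S : Symmetry k V) (hS : S.IsEvenOfRank 2) (hdet : S.HasCentralDet)
    (c : k) (hc : c ≠ 0)
    (α₁ α₂ : ℝ) (hα₁ : 1 - (n : ℝ) * α₁ + α₁ ^ 2 = 0) (hα₂ : 1 - (n : ℝ) * α₂ + α₂ ^ 2 = 0)
    (hα : α₁ < α₂) :
    ∃ ρ : S.sl →ₗ[k] Module.End k (S.Hyperboloid x c),
      S.IsAdjointAction x ρ ∧ (∀ ρ', S.IsAdjointAction x ρ' → ρ' = ρ) ∧
      (∀ μ : k, Module.End.HasEigenvalue (S.casimirOp x ρ) μ → ∃ r : ℝ, μ = (r : k)) ∧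
      (∀ t : ℝ, FiniteDimensional k (eigenspacesLE (S.casimirOp x ρ) t)) ∧
      (∃ β : ℝ, 0 < β ∧
        limsup (fun t : ℝ => (((eigenvalueCount (S.casimirOp x ρ) t : ℝ) /
          α₂ ^ (√(2 * t) + 2) : ℝ) : EReal)) atTop = (β : EReal) ∧
        liminf (fun t : ℝ => (((eigenvalueCount (S.casimirOp x ρ) t : ℝ) /
          α₂ ^ √(2 * t) : ℝ) : EReal)) atTop = (β : EReal)) ∧
      ¬ ∃ L : EReal, Tendsto (fun t : ℝ => (((eigenvalueCount (S.casimirOp x ρ) t : ℝ) /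
          α₂ ^ √(2 * t) : ℝ) : EReal)) atTop (𝓝 L) := by

  obtain ⟨F, he, hF⟩ := hdet.exists_form x
  obtain ⟨Φ, ρ, hρ, hcas⟩ := RankTwoForm.exists_adjointAction he hF c
  have hdual := RankTwoForm.B_f_e he
  have hW : ∀ r, ∀ a ∈ RankTwoForm.evenComponent Φ r,
      S.casimirOp x ρ a = ((casimirValue r : ℝ) : k) • a := fun r a ha => by
    rw [hcas ((2 * r : ℕ) : k) a ha, casimirValue]
    congr 1
    push_cast
    ring
  have htop := RankTwoForm.iSup_evenComponent Φ
  have hfin : ∀ r, Module.Finite k (RankTwoForm.evenComponent Φ r) := fun r =>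
    have := (RankTwoForm.finite_deg hdual (2 * r)).1
    Module.Finite.equiv (RankTwoForm.evenComponentEquiv Φ r).symm
  have hsum : α₁ + α₂ = n := by
    have h : (α₂ - α₁) * (α₁ + α₂ - n) = 0 := by linear_combination hα₂ - hα₁
    linarith [(mul_eq_zero.1 h).resolve_left (sub_pos.2 hα).ne']
  have hprod : α₁ * α₂ = 1 := by linear_combination α₁ * hsum - hα₁
  have hα₂' : 1 < α₂ := by
    have : (2 : ℝ) < n := by exact_mod_cast hn
    linarith
  have hd := closed_form_of_recurrence hα₁ hα₂ hα
    (d := fun m => Module.finrank k (F.deg (m : k)))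
    (by rw [Nat.cast_zero]; exact RankTwoForm.finrank_deg_zero)
    (by rw [Nat.cast_one, RankTwoForm.finrank_deg_one hdual, Fintype.card_fin])
    fun m => by simpa only [Fintype.card_fin] using RankTwoForm.finrank_deg_add_two hdual m
  have hN : ∀ t : ℝ, 0 ≤ t → (eigenvalueCount (S.casimirOp x ρ) t : ℝ) =
      (Module.finrank k (F.deg ((level t : ℕ) : k)) : ℝ) ^ 2 := fun t ht => by
    rw [eigenvalueCount_of_nonneg hW htop hfin ht, ← sum_even_eq_sq hprod hα hd, Nat.cast_sum]
    exact Finset.sum_congr rfl fun r _ => by rw [(RankTwoForm.evenComponentEquiv Φ r).finrank_eq]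
  exact ⟨ρ, hρ, fun ρ' hρ' => hρ.unique hρ', fun μ => exists_real_of_hasEigenvalue hW htop,
    finite_eigenspacesLE hW htop hfin,
    limsup_liminf_of_level hα₂' (inv_pos.2 (pow_pos (sub_pos.2 hα) 2)) hN
      (fun r => sq_nonneg _) (tendsto_sq_div hprod hα hα₂' hd)⟩
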